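/- Let $M$ be a finite-dimensional paracompact (Hausdorff) smooth manifold, $\pi:TM\to M$ its tangent bundle, $\mathcal TM\subset TM$ the slit tangent bundle, and call sections of the pullback bundle $\pi^{-1}(TM)$ $\pi$-vector fields. Let $\rho:T\mathcal TM\to\pi^{-1}(TM)$ be the map induced by $d\pi$, $\gamma:\pi^{-1}(TM)\to T\mathcal TM$ the vertical lift, $J=\gamma\circ\rho$, $\overline\eta(u)=(u,u)$, $\mathcal C=\gamma\overline\eta$, and $d_Jf=df\circ J$. The exterior derivative is normalised by $d\alpha(X,Y)=X\cdot\alpha(Y)-Y\cdot\alpha(X)-\alpha([X,Y])$. For a (possibly conic pseudo-) Finsler structure $F$ with energy $E=\tfrac12F^2$ let $g(\rho X,\rho Y)=dd_JE(JX,Y)$ be its metric tensor, $G$ its geodesic spray ($i_G\,dd_JE=-dE$), $\Gamma=[J,G]$ (i.e. $\Gamma X=[JX,G]-J[X,G]$) its Barthel connection, $h=\tfrac12(I+\Gamma)$ and $v=\tfrac12(I-\Gamma)$ the horizontal and vertical projectors, $\beta$ the horizontal map ($\beta\circ\rho=h$, $\rho\circ\beta=\mathrm{id}$), and $D^\circ$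 its Berwald connection, determined by $$D^\circ_{\gamma\overline W}\overline Z=\rho[\gamma\overline W,\beta\overline Z],\qquad \gamma D^\circ_{\beta\overline W}\overline Z=v[\beta\overline W,\gamma\overline Z].$$ Let $F:TM\to[0,\infty)$ be a Finsler structure: continuous on $TM$, smooth on $\mathcal TM$, positively homogeneous of degree $1$ in the fibres, with $dd_JE$ of maximal rank on $\mathcal TM$. Let $\overline\varphi$ be a concurrent $\pi$-vector field of $F$, i.e. a smooth nowhere vanishing $\pi$-vector field on $\mathcal TM$ with $\nabla_{\beta\overline W}\overline\varphi=-\overline W=D^\circ_{\beta\overline W}\overline\varphi$ and $\nabla_{\gamma\overline W}\overline\varphi=0=D^\circ_{\gamma\overline W}\overline\varphi$ for all $\overline W$, where $\nabla$ is the Cartan connection of $F$. Put $\Phi=g(\overline\varphi,\overline\eta)$, $p^2=g(\overline\varphi,\overline\varphi)$, $\mathcal D=\{u\in\mathcal TM: F(u)>\Phi(u)\}$ and $$\widehat F=\frac{F^2}{F-\Phi}\quad\text{on }\mathcal D .$$ Assume that $\widehat F$ is a conic pseudo-Finsler structure on $\mathcal D$ (that is, $\mathcal D$ is a non-empty open subset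 of $\mathcal TM$, invariant under positive scalings, with $\pi(\mathcal D)=M$ and connected fibres; $\widehat F\ge 0$ is smooth and positively homogeneous of degree $1$ on $\mathcal D$; and $dd_J(\tfrac12\widehat F^2)$ has maximal rank on $\mathcal D$) and that $F(1+2p^2)-3\Phi\neq0$ on $\mathcal D$. Denote the objects of $\widehat F$ by hats, and set $$f_1=\frac{F(4\Phi-F)}{F(1+2p^2)-3\Phi},\qquad f_2=\frac{2F^3}{F(1+2p^2)-3\Phi}.$$ Then for all smooth $\pi$-vector fields $\overline W,\overline Z$ on an open subset of $\mathcal D$: (1) $\widehat{D^\circ}_{\gamma\overline W}\overline Z=D^\circ_{\gamma\overline W}\overline Z$; (2) $$\begin{aligned}\widehat{D^\circ}_{\widehat\beta\,\overline W}\overline Z={}&D^\circ_{\beta\overline W}\overline Z-\tfrac12\bigl\{f_1D^\circ_{\gamma\overline W}\overline Z+d_Jf_1(\beta\overline W)\,D^\circ_{\gamma\overline\eta}\overline Z-d_Jf_1(\beta\overline W)\,\overline Z-d_Jf_1(\beta\overline Z)\,\overline W-d_Jf_2(\beta\overline W)\,D^\circ_{\gamma\overline\varphi}\overline Z\bigr\}\\&+\tfrac12\bigl\{dd_Jf_1(\gamma\overline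 Z,\beta\overline W)\,\overline\eta-dd_Jf_2(\gamma\overline Z,\beta\overline W)\,\overline\varphi\bigr\}.\end{aligned}$$ -/

import Mathlib

open Bundle Set VectorField
open scoped Manifold ContDiff Topology

noncomputable section

namespace Finsler

section Bundles

variable (E : Type*) [NormedAddCommGroup E] [NormedSpace ℝ E]
  (M : Type*) [TopologicalSpace M] [ChartedSpace E M] [IsManifold 𝓘(ℝ, E) ∞ M]

/-- The tangent bundle `TM` of a smooth manifold `M` modelled on `E`. -/
abbrev TM : Type _ := TangentBundle 𝓘(ℝ, E) M

/-- Vector fields on `TM` (not assumed smooth); fields on an open set `U ⊆ TM` are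
represented by fields on `TM`, whose values off `U` are irrelevant. -/
abbrev VField : Type _ := ∀ u : TM E M, TangentSpace 𝓘(ℝ, E).tangent u

/-- `π`-vector fields: sections of the pullback of `TM → M` along `π : TM → M`
(not assumed smooth; the same convention for open subsets). -/
abbrev PiField : Type _ := ∀ u : TM E M, TangentSpace 𝓘(ℝ, E) u.proj

/-- The slit tangent bundle, as an open subset of `TM`. -/
def slit : Set (TM E M) := {u | u.2 ≠ 0}

end Bundles

section Calculus

variable {E : Type*} [NormedAddCommGroup E] [NormedSpace ℝ E]
  {M : Type*} [TopologicalSpace M] [ChartedSpace E M] [IsManifold 𝓘(ℝ, E) ∞ M]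

/-- Smoothness of a real function on a subset of `TM`. -/
def SmoothFun (f : TM E M → ℝ) (U : Set (TM E M)) : Prop :=
  ContMDiffOn 𝓘(ℝ, E).tangent 𝓘(ℝ, ℝ) ∞ f U

/-- Smoothness of a `π`-vector field on a subset of `TM`. -/
def SmoothPi (Z : PiField E M) (U : Set (TM E M)) : Prop :=
  ContMDiffOn 𝓘(ℝ, E).tangent 𝓘(ℝ, E).tangent ∞ (fun u => (⟨u.proj, Z u⟩ : TM E M)) U

/-- The map `ρ : T(TM) → π⁻¹(TM)`, that is `dπ`. -/
def rho (u : TM E M) :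
    TangentSpace 𝓘(ℝ, E).tangent u →L[ℝ] TangentSpace 𝓘(ℝ, E) u.proj :=
  mfderiv 𝓘(ℝ, E).tangent 𝓘(ℝ, E) (fun v : TM E M => v.proj) u

/-- The inclusion into `TM` of the fibre over `x`, a vector space with underlying space `E`. -/
def fibreIncl (x : M) (w : E) : TM E M := ⟨x, w⟩

/-- The vertical lift `γ : π⁻¹(TM) → V(TM)`: the derivative at `u` of the inclusion into `TM`
of the fibre through `u`. -/
def gam (u : TM E M) :
    TangentSpace 𝓘(ℝ, E) u.proj →L[ℝ] TangentSpace 𝓘(ℝ, E).tangent u :=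
  mfderiv 𝓘(ℝ, E) 𝓘(ℝ, E).tangent (fibreIncl (E := E) u.proj) u.2

/-- The vertical endomorphism `J = γ ∘ ρ`. -/
def vJ (u : TM E M) :
    TangentSpace 𝓘(ℝ, E).tangent u →L[ℝ] TangentSpace 𝓘(ℝ, E).tangent u :=
  (gam u).comp (rho u)

/-- The tautological `π`-vector field `η`. -/
def eta : PiField E M := fun u => u.2

/-- The vertical vector field `γ Z` of a `π`-vector field `Z`. -/
def gamF (Z : PiField E M) : VField E M := fun u => gam u (Z u)

/-- The Liouville vector field `C = γ η`. -/
def liouville : VField E M := gamF eta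

/-- The Lie bracket of vector fields on `TM`. -/
def bracket (X Y : VField E M) : VField E M := mlieBracket 𝓘(ℝ, E).tangent X Y

/-- The differential `df` of a function on `TM`; `df u (X u)` is `X · f` at `u`. -/
def df (f : TM E M → ℝ) (u : TM E M) : TangentSpace 𝓘(ℝ, E).tangent u →L[ℝ] ℝ :=
  mfderiv 𝓘(ℝ, E).tangent 𝓘(ℝ, ℝ) f u

/-- The `1`-form `d_J f = df ∘ J`. -/
def dJ (f : TM E M → ℝ) (u : TM E M) : TangentSpace 𝓘(ℝ, E).tangent u →L[ℝ] ℝ :=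
  (df f u).comp (vJ u)

/-- A local extension of a tangent vector of `TM` at `u` to a vector field, smooth near `u`. -/
def extV {u : TM E M} (ξ : TangentSpace 𝓘(ℝ, E).tangent u) : VField E M :=
  FiberBundle.extend (E × E) ξ

/-- A local extension of `z ∈ T_{π u} M` to a `π`-vector field, smooth near `u`. -/
def extPi {u : TM E M} (z : TangentSpace 𝓘(ℝ, E) u.proj) : PiField E M :=
  fun v => FiberBundle.extend E z v.proj

/-- The exterior derivative of a `1`-form on `TM`:
`dα(X, Y) = X · α(Y) - Y · α(X) - α([X, Y])`. The value at `u` depends on `X u`, `Y u` only. -/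
def extD (α : ∀ u : TM E M, TangentSpace 𝓘(ℝ, E).tangent u →L[ℝ] ℝ) (u : TM E M)
    (ξ ζ : TangentSpace 𝓘(ℝ, E).tangent u) : ℝ :=
  df (fun v => α v (extV ζ v)) u ξ - df (fun v => α v (extV ξ v)) u ζ
    - α u (bracket (extV ξ) (extV ζ) u)

/-- The `2`-form `d d_J f`. -/
def ddJ (f : TM E M → ℝ) (u : TM E M) (ξ ζ : TangentSpace 𝓘(ℝ, E).tangent u) : ℝ :=
  extD (dJ f) u ξ ζ

/-- A tangent vector of `TM` at `u` that `ρ` maps to `w` (it exists, as `ρ` is onto). -/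
def lift (u : TM E M) (w : TangentSpace 𝓘(ℝ, E) u.proj) : TangentSpace 𝓘(ℝ, E).tangent u :=
  Function.invFun (rho u) w

/-- The inverse of `γ` on vertical vectors (`γ` is injective). -/
def gamInv (u : TM E M) (ξ : TangentSpace 𝓘(ℝ, E).tangent u) : TangentSpace 𝓘(ℝ, E) u.proj :=
  Function.invFun (gam u) ξ

end Calculus

section Connections

variable {E : Type*} [NormedAddCommGroup E] [NormedSpace ℝ E]
  {M : Type*} [TopologicalSpace M] [ChartedSpace E M] [IsManifold 𝓘(ℝ, E) ∞ M]

/-- The energy `½ F²`. -/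
def energy (F : TM E M → ℝ) : TM E M → ℝ := fun u => (1 / 2) * F u ^ 2

/-- The metric tensor: `g(ρ W, ρ Z) = d d_J (½ F²) (J W, Z)`. -/
def metric (F : TM E M → ℝ) (u : TM E M) (w z : TangentSpace 𝓘(ℝ, E) u.proj) : ℝ :=
  ddJ (energy F) u (gam u w) (lift u z)

/-- The geodesic spray of `F`: at each point the vector `G` with `i_G d d_J (½ F²) = -d(½ F²)`
(there is exactly one wherever `d d_J (½ F²)` is nondegenerate). -/
def geodesicSpray (F : TM E M → ℝ) : VField E M := fun u =>
  Classical.epsilon fun ξ => ∀ ζ, ddJ (energy F) u ξ ζ = -df (energy F) u ζ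

/-- The Barthel connection `Γ = [J, G]`, `G` the geodesic spray of `F`:
`Γ X = [J X, G] - J [X, G]`. The value at `u` depends on `X u` only. -/
def barthel (F : TM E M → ℝ) (u : TM E M) (ξ : TangentSpace 𝓘(ℝ, E).tangent u) :
    TangentSpace 𝓘(ℝ, E).tangent u :=
  bracket (fun v => vJ v (extV ξ v)) (geodesicSpray F) u
    - vJ u (bracket (extV ξ) (geodesicSpray F) u)

/-- The horizontal projector `h = ½ (I + Γ)`. -/
def hproj (F : TM E M → ℝ) (u : TM E M) (ξ : TangentSpace 𝓘(ℝ, E).tangent u) :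
    TangentSpace 𝓘(ℝ, E).tangent u :=
  (1 / 2 : ℝ) • (ξ + barthel F u ξ)

/-- The vertical projector `v = ½ (I - Γ)`. -/
def vproj (F : TM E M → ℝ) (u : TM E M) (ξ : TangentSpace 𝓘(ℝ, E).tangent u) :
    TangentSpace 𝓘(ℝ, E).tangent u :=
  (1 / 2 : ℝ) • (ξ - barthel F u ξ)

/-- The horizontal map `β`, determined by `β ∘ ρ = h`; it is the inverse of `ρ` on the
horizontal space `ker v`. -/
def beta (F : TM E M → ℝ) (u : TM E M) (w : TangentSpace 𝓘(ℝ, E) u.proj) :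
    TangentSpace 𝓘(ℝ, E).tangent u :=
  hproj F u (lift u w)

/-- The horizontal vector field `β Z` of a `π`-vector field `Z`. -/
def betaF (F : TM E M → ℝ) (Z : PiField E M) : VField E M := fun u => beta F u (Z u)

/-- The Berwald connection `D°` of `F`, with `X = v X + h X`:
`D°_{v X} Z = ρ [v X, β Z]` and `γ D°_{h X} Z = v [h X, γ Z]`. -/
def berwald (F : TM E M → ℝ) (X : VField E M) (Z : PiField E M) : PiField E M := fun u =>
  rho u (bracket (fun v => vproj F v (X v)) (betaF F Z) u)
    + gamInv u (vproj F u (bracket (fun v => hproj F v (X v)) (gamF Z) u))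

/-- The vector `V` with `g(V, z) = α z` for all `z`
(there is exactly one when `g` is nondegenerate and `α` linear). -/
def sharp (F : TM E M → ℝ) (u : TM E M) (α : TangentSpace 𝓘(ℝ, E) u.proj → ℝ) :
    TangentSpace 𝓘(ℝ, E) u.proj :=
  Classical.epsilon fun V => ∀ z, metric F u V z = α z

/-- The metric tensor on `π`-vector fields. -/
def metricF (F : TM E M → ℝ) (Y Z : PiField E M) : TM E M → ℝ := fun u => metric F u (Y u) (Z u)

/-- The bracket `ρ [X, Y]`. -/
def rhoBracket (X Y : VField E M) : PiField E M := fun u => rho u (bracket X Y u)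

/-- The vertical part `∇_{γ X} Y` of the Cartan connection of `F`:
`2 g(∇_{γX} Y, Z) = γX · g(Y, Z) + g(Y, ρ[βZ, γX]) + g(Z, ρ[γX, βY])`. -/
def cartanV (F : TM E M → ℝ) (X Y : PiField E M) : PiField E M := fun u =>
  sharp F u fun z =>
    let Z : PiField E M := extPi z
    (1 / 2) * (df (metricF F Y Z) u (gamF X u)
      + metricF F Y (rhoBracket (betaF F Z) (gamF X)) u
      + metricF F Z (rhoBracket (gamF X) (betaF F Y)) u)

/-- The horizontal part `∇_{β X} Y` of the Cartan connection of `F`: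
`2 g(∇_{βX} Y, Z) = βX · g(Y, Z) + βY · g(Z, X) - βZ · g(X, Y)
- g(X, ρ[βY, βZ]) + g(Y, ρ[βZ, βX]) + g(Z, ρ[βX, βY])`. -/
def cartanH (F : TM E M → ℝ) (X Y : PiField E M) : PiField E M := fun u =>
  sharp F u fun z =>
    let Z : PiField E M := extPi z
    (1 / 2) * (df (metricF F Y Z) u (betaF F X u)
      + df (metricF F Z X) u (betaF F Y u)
      - df (metricF F X Y) u (betaF F Z u)
      - metricF F X (rhoBracket (betaF F Y) (betaF F Z)) u
      + metricF F Y (rhoBracket (betaF F Z) (betaF F X)) u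
      + metricF F Z (rhoBracket (betaF F X) (betaF F Y)) u)

/-- The `2`-form `d d_J (½ F²)` has maximal rank at every point of `A`. -/
def MaximalRank (F : TM E M → ℝ) (A : Set (TM E M)) : Prop :=
  ∀ u ∈ A, ∀ ξ : TangentSpace 𝓘(ℝ, E).tangent u,
    (∀ ζ, ddJ (energy F) u ξ ζ = 0) → ξ = 0

/-- `F` is a (regular) Finsler structure on `M`. -/
structure IsFinsler (F : TM E M → ℝ) : Prop where
  nonneg : ∀ u, 0 ≤ F u
  smooth : SmoothFun F (slit E M)
  continuous : Continuous F
  homogeneous : ∀ x : M, ∀ y : TangentSpace 𝓘(ℝ, E) x, ∀ t : ℝ, 0 < t →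
    F ⟨x, t • y⟩ = t * F ⟨x, y⟩
  maximalRank : MaximalRank F (slit E M)

/-- `A` is a conic sub-bundle of `TM` with connected fibres. -/
structure IsConicSubbundle (A : Set (TM E M)) : Prop where
  nonempty : A.Nonempty
  isOpen : IsOpen A
  subset_slit : A ⊆ slit E M
  scaling : ∀ x : M, ∀ y : TangentSpace 𝓘(ℝ, E) x, ∀ t : ℝ, 0 < t →
    (⟨x, y⟩ : TM E M) ∈ A → (⟨x, t • y⟩ : TM E M) ∈ A
  surjective : ∀ x : M, ∃ y : TangentSpace 𝓘(ℝ, E) x, (⟨x, y⟩ : TM E M) ∈ A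
  connected : ∀ x : M, IsConnected {y : TangentSpace 𝓘(ℝ, E) x | (⟨x, y⟩ : TM E M) ∈ A}

/-- `F` is a conic pseudo-Finsler structure on `M` with conic domain `A`. -/
structure IsConicPseudoFinsler (A : Set (TM E M)) (F : TM E M → ℝ) : Prop where
  conic : IsConicSubbundle A
  nonneg : ∀ u ∈ A, 0 ≤ F u
  smooth : SmoothFun F A
  homogeneous : ∀ x : M, ∀ y : TangentSpace 𝓘(ℝ, E) x, ∀ t : ℝ, 0 < t →
    (⟨x, y⟩ : TM E M) ∈ A → F ⟨x, t • y⟩ = t * F ⟨x, y⟩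
  maximalRank : MaximalRank F A

/-- `φ` is a concurrent `π`-vector field for `F`: it is smooth and nowhere zero, with
`∇_{βW} φ = -W = D°_{βW} φ` and `∇_{γW} φ = 0 = D°_{γW} φ` for all `π`-vector fields `W`. The
identities are local; they are required for fields `W` on open subsets of the slit bundle. -/
structure IsConcurrent (F : TM E M → ℝ) (φ : PiField E M) : Prop where
  smooth : SmoothPi φ (slit E M)
  ne_zero : ∀ u ∈ slit E M, φ u ≠ 0
  cartan_beta : ∀ U : Set (TM E M), IsOpen U → U ⊆ slit E M → ∀ W : PiField E M, SmoothPi W U →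
    ∀ u ∈ U, cartanH F W φ u = -W u
  berwald_beta : ∀ U : Set (TM E M), IsOpen U → U ⊆ slit E M → ∀ W : PiField E M, SmoothPi W U →
    ∀ u ∈ U, berwald F (betaF F W) φ u = -W u
  cartan_gamma : ∀ U : Set (TM E M), IsOpen U → U ⊆ slit E M → ∀ W : PiField E M, SmoothPi W U →
    ∀ u ∈ U, cartanV F W φ u = 0
  berwald_gamma : ∀ U : Set (TM E M), IsOpen U → U ⊆ slit E M → ∀ W : PiField E M, SmoothPi W U →
    ∀ u ∈ U, berwald F (gamF W) φ u = 0

end Connections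

section Matsumoto

variable {E : Type*} [NormedAddCommGroup E] [NormedSpace ℝ E]
  {M : Type*} [TopologicalSpace M] [ChartedSpace E M] [IsManifold 𝓘(ℝ, E) ∞ M]

/-- `Φ = g(φ, η)`. -/
def Phi (F : TM E M → ℝ) (φ : PiField E M) : TM E M → ℝ := metricF F φ eta

/-- `p² = g(φ, φ)`. -/
def pSq (F : TM E M → ℝ) (φ : PiField E M) : TM E M → ℝ := metricF F φ φ

/-- The conic domain `{F > Φ}` in the slit tangent bundle. -/
def matsumotoDomain (F : TM E M → ℝ) (φ : PiField E M) : Set (TM E M) :=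
  {u | u ∈ slit E M ∧ Phi F φ u < F u}

/-- The changed metric `F² / (F - Φ)`. -/
def matsumoto (F : TM E M → ℝ) (φ : PiField E M) : TM E M → ℝ :=
  fun u => F u ^ 2 / (F u - Phi F φ u)

/-- The denominator `F (1 + 2 p²) - 3 Φ`. -/
def matsumotoDenom (F : TM E M → ℝ) (φ : PiField E M) : TM E M → ℝ :=
  fun u => F u * (1 + 2 * pSq F φ u) - 3 * Phi F φ u

/-- `f₁ = F (4 Φ - F) / (F (1 + 2 p²) - 3 Φ)`. -/
def f₁ (F : TM E M → ℝ) (φ : PiField E M) : TM E M → ℝ :=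
  fun u => F u * (4 * Phi F φ u - F u) / matsumotoDenom F φ u

/-- `f₂ = 2 F³ / (F (1 + 2 p²) - 3 Φ)`. -/
def f₂ (F : TM E M → ℝ) (φ : PiField E M) : TM E M → ℝ :=
  fun u => 2 * F u ^ 3 / matsumotoDenom F φ u

end Matsumoto

end Finsler

end

noncomputable section

namespace Finsler

/-! ### Sprays of homogeneous nondegenerate energies on an open conic subset of E × E. -/

section Flat

variable {E : Type*} [NormedAddCommGroup E] [NormedSpace ℝ E]

/-! Both formulas follow from the spray of the changed metric, which is the old spray minus f₁ times
the Liouville field plus f₂ times the vertical lift of φ.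

In a chart of `TM` a point is q = (x, y), γ is the inclusion of the fibre directions, and a spray is
S = (y, S₂). There D°_{γW} Z is the derivative of Z along (0, W), in which no metric appears; this
is (1), see `dB_berwald_gamF`. The horizontal lift of w is hor w = (w, ½ ∂_w S₂), with ∂_w the
derivative along (0, w), and D°_{βW} Z = dZ(hor W) - ½ D²S₂((0, Z), (0, W)). Replacing S₂ by S₂ + f₂
φ - f₁ y, with φ constant along the fibres, gives (2); this is `flatBerwald_hat`.

The spray formula `spray_hat` rests on concurrence. Let L = ½ F². Vanishing of the vertical
derivatives makes φ and p² constant along the fibres. Horizontal lifts always annihilate dL;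
differentiating dL(hor w) = 0 along (0, φ) and inserting D°_{βw} φ = -w gives dΦ(hor w) = -F ∂_w F.
With dΦ(0, φ) = p² and dF(0, φ) = Φ / F, the Euler-Lagrange equation of the new energy in direction
w is linear in ∂_w F and ∂_w Φ, and f₁, f₂ are the values that make both coefficients vanish.

What remains is translation: `ddJ`, brackets, the Barthel, Berwald and Cartan data are computed in
the charts of `TM`, where γ and ρ become the inclusion of the second factor and the projection to
the first. -/

lemma fderiv_clm_apply_apply {V G H : Type*} [NormedAddCommGroup V] [NormedSpace ℝ V]
    [NormedAddCommGroup G] [NormedSpace ℝ G] [NormedAddCommGroup H] [NormedSpace ℝ H]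
    {c : V → G →L[ℝ] H} {w : V → G} {q : V} (hc : DifferentiableAt ℝ c q)
    (hw : DifferentiableAt ℝ w q) (ξ : V) :
    fderiv ℝ (fun y => c y (w y)) q ξ = fderiv ℝ c q ξ (w q) + c q (fderiv ℝ w q ξ) := by
  rw [fderiv_clm_apply hc hw]
  simp [add_comm]

lemma fderiv_apply_const {V G H : Type*} [NormedAddCommGroup V] [NormedSpace ℝ V]
    [NormedAddCommGroup G] [NormedSpace ℝ G] [NormedAddCommGroup H] [NormedSpace ℝ H]
    {c : V → G →L[ℝ] H} {q : V} (hc : DifferentiableAt ℝ c q) (z : G) (ξ : V) :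
    fderiv ℝ (fun y => c y z) q ξ = fderiv ℝ c q ξ z := by
  rw [fderiv_clm_apply_apply hc (differentiableAt_const z)]
  simp

/-- The map `(x, y) ↦ (0, x)`. -/
def shift : E × E →L[ℝ] E × E :=
  (ContinuousLinearMap.inr ℝ E E).comp (ContinuousLinearMap.fst ℝ E E)

@[simp] lemma shift_apply (q : E × E) : shift q = (0, q.1) := rfl

/-- The coordinate expression of `d d_J L`. -/
def flatForm (L : E × E → ℝ) (q ξ ζ : E × E) : ℝ :=
  fderiv ℝ (fderiv ℝ L) q ξ (0, ζ.1) - fderiv ℝ (fderiv ℝ L) q ζ (0, ξ.1)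

/-- The form `flatForm` as a continuous bilinear map. -/
def flatFormL (L : E × E → ℝ) (q : E × E) : E × E →L[ℝ] E × E →L[ℝ] ℝ :=
  (ContinuousLinearMap.precomp ℝ (shift (E := E))).comp (fderiv ℝ (fderiv ℝ L) q)
    - (fderiv ℝ (fderiv ℝ L) q).comp shift

/-- The energy `L` is smooth, homogeneous of degree two and nondegenerate on the conic set `Ω`. -/
structure FlatRegular (Ω : Set (E × E)) (L : E × E → ℝ) : Prop where
  isOpen : IsOpen Ω
  smooth : ContDiffOn ℝ ∞ L Ω
  scaling : ∀ q ∈ Ω, ∀ t : ℝ, 0 < t → (q.1, t • q.2) ∈ Ω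
  homogeneous : ∀ q ∈ Ω, ∀ t : ℝ, 0 < t → L (q.1, t • q.2) = t ^ 2 * L q
  nondegenerate : ∀ q ∈ Ω, ∀ ξ, (∀ ζ, flatForm L q ξ ζ = 0) → ξ = 0

/-- `S` is the coordinate expression on `Ω` of the spray of the energy `L`. -/
structure FlatSpray (Ω : Set (E × E)) (L : E × E → ℝ) (S : E × E → E × E) : Prop
    extends FlatRegular Ω L where
  spray : ∀ q ∈ Ω, ∀ ζ, flatForm L q (S q) ζ = -fderiv ℝ L q ζ

/-- Dilations of the fibres. -/
def dil (t : ℝ) : E × E →L[ℝ] E × E :=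
  (ContinuousLinearMap.fst ℝ E E).prod (t • ContinuousLinearMap.snd ℝ E E)

@[simp] lemma dil_apply (t : ℝ) (q : E × E) : dil t q = (q.1, t • q.2) := rfl

namespace FlatRegular

variable {Ω : Set (E × E)} {L : E × E → ℝ}

lemma contDiffAt (h : FlatRegular Ω L) {q : E × E} (hq : q ∈ Ω) : ContDiffAt ℝ ∞ L q :=
  h.smooth.contDiffAt (h.isOpen.mem_nhds hq)

lemma contDiffAt_fderiv (h : FlatRegular Ω L) {q : E × E} (hq : q ∈ Ω) :
    ContDiffAt ℝ ∞ (fderiv ℝ L) q :=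
  (h.contDiffAt hq).fderiv_right (by simp)

lemma contDiffAt_fderiv_fderiv (h : FlatRegular Ω L) {q : E × E} (hq : q ∈ Ω) :
    ContDiffAt ℝ ∞ (fderiv ℝ (fderiv ℝ L)) q :=
  (h.contDiffAt_fderiv hq).fderiv_right (by simp)

lemma differentiableAt_fderiv (h : FlatRegular Ω L) {q : E × E} (hq : q ∈ Ω) :
    DifferentiableAt ℝ (fderiv ℝ L) q :=
  (h.contDiffAt_fderiv hq).differentiableAt (by simp)

lemma symm (h : FlatRegular Ω L) {q : E × E} (hq : q ∈ Ω) (ξ ζ : E × E) :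
    fderiv ℝ (fderiv ℝ L) q ξ ζ = fderiv ℝ (fderiv ℝ L) q ζ ξ :=
  ((h.contDiffAt hq).isSymmSndFDerivAt (by simp; exact ENat.LEInfty.out)).eq ξ ζ

/-- Symmetry of the second derivative moves ξ into the outer slot of the second term, which makes
the form a composition of continuous linear maps. The symmetry is only available where L is smooth.
-/
lemma flatFormL_apply (h : FlatRegular Ω L) {q : E × E} (hq : q ∈ Ω) (ξ ζ : E × E) :
    flatFormL L q ξ ζ = flatForm L q ξ ζ := by
  rw [flatForm, h.symm hq ζ]
  rfl

lemma eventually_mem (h : FlatRegular Ω L) {q : E × E} (hq : q ∈ Ω) : ∀ᶠ r in 𝓝 q, r ∈ Ω :=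
  h.isOpen.mem_nhds hq

lemma euler (h : FlatRegular Ω L) {q : E × E} (hq : q ∈ Ω) :
    fderiv ℝ L q (0, q.2) = 2 * L q := by
  have hd : DifferentiableAt ℝ L q := (h.contDiffAt hq).differentiableAt (by simp)
  have h1 : HasDerivAt (fun t : ℝ => (q.1, t • q.2)) ((0 : E), q.2) 1 := by
    have := (hasDerivAt_const (1 : ℝ) q.1).prodMk ((hasDerivAt_id (1 : ℝ)).smul_const q.2)
    simpa using this
  have h2 : HasDerivAt (fun t : ℝ => L (q.1, t • q.2)) (fderiv ℝ L q (0, q.2)) 1 := by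
    have hd' : HasFDerivAt L (fderiv ℝ L q) (q.1, (1 : ℝ) • q.2) := by
      simpa using hd.hasFDerivAt
    exact hd'.comp_hasDerivAt (1 : ℝ) h1
  have h3 : HasDerivAt (fun t : ℝ => t ^ 2 * L q) (2 * L q) 1 := by
    have := (hasDerivAt_pow 2 (1 : ℝ)).mul_const (L q)
    simpa using this
  have h4 : (fun t : ℝ => L (q.1, t • q.2)) =ᶠ[𝓝 1] fun t : ℝ => t ^ 2 * L q := by
    filter_upwards [lt_mem_nhds (zero_lt_one' ℝ)] with t ht using h.homogeneous q hq t ht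
  exact h2.unique (h3.congr_of_eventuallyEq h4)

lemma euler_fderiv (h : FlatRegular Ω L) {q : E × E} (hq : q ∈ Ω) (ζ : E × E) :
    fderiv ℝ (fderiv ℝ L) q ζ (0, q.2) + fderiv ℝ L q (0, ζ.2) = 2 * fderiv ℝ L q ζ := by
  have hd : DifferentiableAt ℝ L q := (h.contDiffAt hq).differentiableAt (by simp)
  have h1 : (fun r : E × E => fderiv ℝ L r (0, r.2)) =ᶠ[𝓝 q] fun r => 2 * L r := by
    filter_upwards [h.eventually_mem hq] with r hr using h.euler hr
  have h2 := DFunLike.congr_fun (h1.fderiv_eq (𝕜 := ℝ)) ζ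
  have h3 : fderiv ℝ (fun r : E × E => ((0 : E), r.2)) q ζ = (0, ζ.2) :=
    congrArg (fun T => T ζ) ((ContinuousLinearMap.inr ℝ E E).comp
      (ContinuousLinearMap.snd ℝ E E)).hasFDerivAt.fderiv
  have h4 := fderiv_clm_apply_apply (h.differentiableAt_fderiv hq)
    (w := fun r : E × E => ((0 : E), r.2)) (by fun_prop) ζ
  rw [h3] at h4
  rw [← h4]
  have h5 : fderiv ℝ (fun r => 2 * L r) q ζ = 2 * fderiv ℝ L q ζ := by
    rw [fderiv_const_mul hd]; simp
  exact h2.trans h5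

lemma fderiv_dil (h : FlatRegular Ω L) {q : E × E} (hq : q ∈ Ω) {t : ℝ} (ht : 0 < t)
    (ζ : E × E) : fderiv ℝ L (dil t q) (dil t ζ) = t ^ 2 * fderiv ℝ L q ζ := by
  have hd : DifferentiableAt ℝ L q := (h.contDiffAt hq).differentiableAt (by simp)
  have hd' : DifferentiableAt ℝ L (dil t q) :=
    (h.contDiffAt (h.scaling q hq t ht)).differentiableAt (by simp)
  have h1 : (fun r : E × E => L (dil t r)) =ᶠ[𝓝 q] fun r => t ^ 2 * L r := by
    filter_upwards [h.eventually_mem hq] with r hr using h.homogeneous r hr t ht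
  have h2 := DFunLike.congr_fun (h1.fderiv_eq (𝕜 := ℝ)) ζ
  have h3 : fderiv ℝ (fun r => L (dil t r)) q = (fderiv ℝ L (dil t q)).comp (dil t) :=
    (hd'.hasFDerivAt.comp q (dil (E := E) t).hasFDerivAt).fderiv
  have h4 : fderiv ℝ (fun r => t ^ 2 * L r) q ζ = t ^ 2 * fderiv ℝ L q ζ := by
    rw [fderiv_const_mul hd]; simp
  rw [h3] at h2
  exact h2.trans h4

lemma fderiv_fderiv_dil (h : FlatRegular Ω L) {q : E × E} (hq : q ∈ Ω) {t : ℝ} (ht : 0 < t)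
    (ξ ζ : E × E) : fderiv ℝ (fderiv ℝ L) (dil t q) (dil t ξ) (dil t ζ)
      = t ^ 2 * fderiv ℝ (fderiv ℝ L) q ξ ζ := by
  have hd := h.differentiableAt_fderiv hq
  have hd' : DifferentiableAt ℝ (fderiv ℝ L) (dil t q) :=
    h.differentiableAt_fderiv (h.scaling q hq t ht)
  have h1 : (fun r : E × E => fderiv ℝ L (dil t r) (dil t ζ)) =ᶠ[𝓝 q]
      fun r => t ^ 2 * fderiv ℝ L r ζ := by
    filter_upwards [h.eventually_mem hq] with r hr using h.fderiv_dil hr ht ζ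
  have h2 := DFunLike.congr_fun (h1.fderiv_eq (𝕜 := ℝ)) ξ
  have hc : HasFDerivAt (fun r => fderiv ℝ L (dil t r))
      ((fderiv ℝ (fderiv ℝ L) (dil t q)).comp (dil t)) q :=
    hd'.hasFDerivAt.comp q (dil (E := E) t).hasFDerivAt
  have h3 := fderiv_apply_const hc.differentiableAt (dil t ζ) ξ
  rw [hc.fderiv] at h3
  have h4 : fderiv ℝ (fun r => t ^ 2 * fderiv ℝ L r ζ) q ξ
      = t ^ 2 * fderiv ℝ (fderiv ℝ L) q ξ ζ := by
    rw [fderiv_const_mul (by fun_prop)]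
    simp [fderiv_apply_const hd]
  exact h3.symm.trans (h2.trans h4)

/-- Nondegeneracy is injectivity, and a space and its dual have equal dimension. The inverse yields
both existence and smoothness of the spray. -/
lemma flatFormL_isInvertible [FiniteDimensional ℝ E] (h : FlatRegular Ω L) {q : E × E}
    (hq : q ∈ Ω) : (flatFormL L q).IsInvertible := by
  have hinj : Function.Injective (flatFormL L q : E × E →ₗ[ℝ] E × E →L[ℝ] ℝ) := by
    rw [injective_iff_map_eq_zero]
    intro ξ hξ
    exact h.nondegenerate q hq ξ fun ζ =>
      (h.flatFormL_apply hq ξ ζ).symm.trans (DFunLike.congr_fun hξ ζ)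
  have hdim : Module.finrank ℝ (E × E) = Module.finrank ℝ (E × E →L[ℝ] ℝ) := by
    rw [← (LinearMap.toContinuousLinearMap (𝕜 := ℝ) (E := E × E) (F' := ℝ)).finrank_eq]
    exact Subspace.dual_finrank_eq.symm
  have : FiniteDimensional ℝ (E × E →L[ℝ] ℝ) :=
    (LinearMap.toContinuousLinearMap (𝕜 := ℝ) (E := E × E) (F' := ℝ)).finiteDimensional
  exact ⟨(LinearEquiv.ofInjectiveOfFinrankEq _ hinj hdim).toContinuousLinearEquiv, by
    ext <;> rfl⟩

end FlatRegular

namespace FlatSpray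

variable {Ω : Set (E × E)} {L : E × E → ℝ} {S : E × E → E × E}

lemma unique (h : FlatSpray Ω L S) {q : E × E} (hq : q ∈ Ω) {ξ : E × E}
    (hξ : ∀ ζ, flatForm L q ξ ζ = -fderiv ℝ L q ζ) : ξ = S q := by
  refine sub_eq_zero.1 (h.nondegenerate q hq _ fun ζ => ?_)
  have h1 := h.spray q hq ζ
  have h2 := hξ ζ
  rw [← h.flatFormL_apply hq] at h1 h2 ⊢
  rw [map_sub, sub_apply, h1, h2, sub_self]

/-- Tested on vertical vectors, the spray equation and the differentiated Euler relation say that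
(0, S₁) and (0, y) pair alike with every vector, so their difference lies in the kernel of the form.
-/
lemma fst_eq (h : FlatSpray Ω L S) {q : E × E} (hq : q ∈ Ω) : (S q).1 = q.2 := by
  have key : ((0 : E), (S q).1 - q.2) = 0 := by
    refine h.nondegenerate q hq _ fun ζ => ?_
    have h1 := h.spray q hq (0, ζ.1)
    have h2 := h.euler_fderiv hq (0, ζ.1)
    have h3 : ((0 : E), (S q).1 - q.2) = (0, (S q).1) - (0, q.2) := by simp
    simp only [flatForm] at h1 ⊢
    have h4 : ((0 : E), (0 : E)) = 0 := rfl
    simp only [h3, map_sub, sub_apply, h4, map_zero] at h1 ⊢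
    rw [h.symm hq (0, (S q).1), h.symm hq (0, q.2)]
    linarith
  simpa [sub_eq_zero] using congrArg Prod.snd key

/-- The energy and its derivatives scale by t² under dilations, so t times the dilated spray solves
the spray equation at the dilated point; uniqueness concludes. -/
lemma spray_dil (h : FlatSpray Ω L S) {q : E × E} (hq : q ∈ Ω) {t : ℝ} (ht : 0 < t) :
    S (dil t q) = t • dil t (S q) := by
  refine (h.unique (h.scaling q hq t ht) fun ζ' => ?_).symm
  obtain ⟨ζ, rfl⟩ : ∃ ζ, dil t ζ = ζ' := ⟨(ζ'.1, t⁻¹ • ζ'.2), by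
    ext <;> simp [smul_smul, ht.ne']⟩
  have h1 := h.spray q hq ζ
  have e1 : ((0 : E), (dil t ζ).1) = t⁻¹ • dil t (0, ζ.1) := by
    simp [smul_smul, ht.ne']
  have e2 : ((0 : E), (t • dil t (S q)).1) = dil t (0, (S q).1) := by simp
  change flatForm L (dil t q) _ _ = -fderiv ℝ L (dil t q) _
  rw [h.fderiv_dil hq ht]
  rw [flatForm, e1, e2, h.fderiv_fderiv_dil hq ht]
  simp only [map_smul, smul_apply, smul_eq_mul]
  rw [h.fderiv_fderiv_dil hq ht]
  rw [flatForm] at h1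
  field_simp
  linear_combination h1

/-- The spray is minus the inverse of the form applied to dL, and inversion is smooth at invertible
maps. -/
lemma contDiffAt_spray [FiniteDimensional ℝ E] (h : FlatSpray Ω L S) {q : E × E} (hq : q ∈ Ω) :
    ContDiffAt ℝ ∞ S q := by
  have h2 := h.contDiffAt_fderiv_fderiv hq
  have hT : ContDiffAt ℝ ∞ (flatFormL L) q := by
    unfold flatFormL
    exact (contDiffAt_const.clm_comp h2).sub (h2.clm_comp contDiffAt_const)
  have : CompleteSpace (E × E) := FiniteDimensional.complete ℝ _
  have hI : ContDiffAt ℝ ∞ (fun r => (flatFormL L r).inverse) q :=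
    ((h.flatFormL_isInvertible hq).contDiffAt_map_inverse).comp q hT
  refine ((hI.clm_apply (h.contDiffAt_fderiv hq)).neg).congr_of_eventuallyEq ?_
  filter_upwards [h.eventually_mem hq] with r hr
  have h3 : flatFormL L r (S r) = -fderiv ℝ L r := by
    refine ContinuousLinearMap.ext fun ζ => ?_
    simpa [h.flatFormL_apply hr] using h.spray r hr ζ
  have h4 : (flatFormL L r).inverse (flatFormL L r (S r)) = S r := by
    obtain ⟨e, he⟩ := h.flatFormL_isInvertible hr
    rw [← he]; simp
  rw [← h4, h3, map_neg]

/-- The horizontal lift of `w` at `q`. -/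
def hor (S : E × E → E × E) (q : E × E) (w : E) : E × E :=
  (w, (1 / 2 : ℝ) • (fderiv ℝ S q (0, w)).2)

variable [FiniteDimensional ℝ E]

lemma fderiv_spray_fst (h : FlatSpray Ω L S) {q : E × E} (hq : q ∈ Ω) (ξ : E × E) :
    (fderiv ℝ S q ξ).1 = ξ.2 := by
  have h1 : (fun r => (S r).1) =ᶠ[𝓝 q] Prod.snd := by
    filter_upwards [h.eventually_mem hq] with r hr using h.fst_eq hr
  have hS := (h.contDiffAt_spray hq).differentiableAt (by simp)
  have h2 := h1.fderiv_eq (𝕜 := ℝ)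
  rw [fderiv.fst hS, fderiv_snd] at h2
  exact DFunLike.congr_fun h2 ξ

/-- Euler's relation for S₂, which is homogeneous of degree two: ∂_y S₂ = 2 S₂. -/
lemma hor_snd (h : FlatSpray Ω L S) {q : E × E} (hq : q ∈ Ω) : hor S q q.2 = S q := by
  have hS := (h.contDiffAt_spray hq).differentiableAt (by simp)
  have h1 : HasDerivAt (fun t : ℝ => (q.1, t • q.2)) ((0 : E), q.2) 1 := by
    have := (hasDerivAt_const (1 : ℝ) q.1).prodMk ((hasDerivAt_id (1 : ℝ)).smul_const q.2)
    simpa using this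
  have h2 : HasDerivAt (fun t : ℝ => S (q.1, t • q.2)) (fderiv ℝ S q (0, q.2)) 1 := by
    have hd' : HasFDerivAt S (fderiv ℝ S q) (q.1, (1 : ℝ) • q.2) := by
      simpa using hS.hasFDerivAt
    exact hd'.comp_hasDerivAt (1 : ℝ) h1
  have h3 : HasDerivAt (fun t : ℝ => t • dil t (S q)) ((S q).1, (2 : ℝ) • (S q).2) 1 := by
    have h4 : HasDerivAt (fun t : ℝ => (t • (S q).1, t ^ 2 • (S q).2))
        ((1 : ℝ) • (S q).1, ((2 : ℕ) * (1 : ℝ) ^ 1) • (S q).2) 1 :=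
      ((hasDerivAt_id (1 : ℝ)).smul_const _).prodMk ((hasDerivAt_pow 2 (1 : ℝ)).smul_const _)
    simp only [dil_apply, Prod.smul_mk, smul_smul, ← pow_two]
    simpa using h4
  have h4 : (fun t : ℝ => S (q.1, t • q.2)) =ᶠ[𝓝 1] fun t : ℝ => t • dil t (S q) := by
    filter_upwards [lt_mem_nhds (zero_lt_one' ℝ)] with t ht using h.spray_dil hq ht
  have h5 := h2.unique (h3.congr_of_eventuallyEq h4)
  rw [hor, h5]
  ext
  · exact (h.fst_eq hq).symm
  · simp

omit [FiniteDimensional ℝ E] in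
lemma fderiv_apply_spray (h : FlatSpray Ω L S) {q : E × E} (hq : q ∈ Ω) :
    fderiv ℝ L q (S q) = 0 := by
  have := h.spray q hq (S q)
  rw [flatForm] at this
  linarith

/-- The energy is constant along horizontal directions. -/
lemma fderiv_hor (h : FlatSpray Ω L S) {q : E × E} (hq : q ∈ Ω) (w : E) :
    fderiv ℝ L q (hor S q w) = 0 := by
  have hS := (h.contDiffAt_spray hq).differentiableAt (by simp)
  -- Differentiating dL(S) = 0 along (0, w) gives D²L(S, (0, w)) + dL(∂_w S) = 0. The first term is
  -- dL(w, 0) by the spray equation and Euler, and ∂_w S = 2 hor w - (w, 0).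
  have h1 : (fun r => fderiv ℝ L r (S r)) =ᶠ[𝓝 q] fun _ => 0 := by
    filter_upwards [h.eventually_mem hq] with r hr using h.fderiv_apply_spray hr
  have h2 := DFunLike.congr_fun (h1.fderiv_eq (𝕜 := ℝ)) (0, w)
  simp only [fderiv_clm_apply_apply (h.differentiableAt_fderiv hq) hS] at h2
  have h3 := h.spray q hq (w, 0)
  have h4 := h.euler_fderiv hq (w, 0)
  rw [flatForm, h.fst_eq hq] at h3
  rw [h.symm hq] at h2
  have h5 : fderiv ℝ S q (0, w) = (2 : ℝ) • hor S q w - (w, 0) := by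
    ext
    · simp [hor, h.fderiv_spray_fst hq, two_smul]
    · simp [hor]
  rw [h5] at h2
  simp only [map_sub, map_smul, smul_eq_mul] at h2 h4
  have h6 : ((0 : E), (0 : E)) = 0 := rfl
  simp only [h6, map_zero] at h4
  have h7 : fderiv ℝ (fun _ : E × E => (0 : ℝ)) q (0, w) = 0 := by simp
  rw [h7] at h2
  simp only at h3
  linarith

end FlatSpray

end Flat

/-! ### Concurrent fields in coordinates and the spray of the changed metric. -/

section FlatMatsumoto

variable {E : Type*} [NormedAddCommGroup E] [NormedSpace ℝ E]

/-- The energy `½ F²` in coordinates. -/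
abbrev flatEnergy (F : E × E → ℝ) : E × E → ℝ := fun q => (1 / 2) * F q ^ 2

/-- The metric tensor in coordinates. -/
def flatMetric (L : E × E → ℝ) (q : E × E) (w z : E) : ℝ :=
  fderiv ℝ (fderiv ℝ L) q (0, w) (0, z)

/-- `φ` is the coordinate expression on `Ω` of a concurrent field of the metric `F`
with spray `S`. -/
structure FlatConcurrent (Ω : Set (E × E)) (F : E × E → ℝ) (S : E × E → E × E) (φ : E × E → E) :
    Prop where
  smooth : ContDiffOn ℝ ∞ F Ω
  spray : FlatSpray Ω (flatEnergy F) S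
  snd_ne : ∀ q ∈ Ω, q.2 ≠ 0
  smooth_field : ContDiffOn ℝ ∞ φ Ω
  vertical : ∀ q ∈ Ω, ∀ w, fderiv ℝ φ q (0, w) = 0
  cartan : ∀ q ∈ Ω, ∀ w z,
    fderiv ℝ (fun r => flatMetric (flatEnergy F) r (φ r) z) q (0, w) = 0
  horizontal : ∀ q ∈ Ω, ∀ w, fderiv ℝ φ q (FlatSpray.hor S q w)
    - (1 / 2 : ℝ) • (fderiv ℝ (fderiv ℝ S) q (0, φ q) (0, w)).2 = -w

lemma hasDerivAt_line {V G : Type*} [NormedAddCommGroup V] [NormedSpace ℝ V]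
    [NormedAddCommGroup G] [NormedSpace ℝ G] {g : V → G} {q : V} (hg : DifferentiableAt ℝ g q)
    (ξ : V) : HasDerivAt (fun t : ℝ => g (q + t • ξ)) (fderiv ℝ g q ξ) 0 :=
  hg.hasFDerivAt.hasLineDerivAt ξ

/-- Restricting to a line turns derivatives of rational expressions in F, Φ and p² into one-variable
computations that end in scalar identities. -/
lemma fderiv_eq_of_line {V G : Type*} [NormedAddCommGroup V] [NormedSpace ℝ V]
    [NormedAddCommGroup G] [NormedSpace ℝ G] {g : V → G} {q ξ : V} {c : G}
    (hg : DifferentiableAt ℝ g q) (h : HasDerivAt (fun t : ℝ => g (q + t • ξ)) c 0) :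
    fderiv ℝ g q ξ = c :=
  (hasDerivAt_line hg ξ).unique h

namespace FlatConcurrent

variable {Ω : Set (E × E)} {F : E × E → ℝ} {S : E × E → E × E} {φ : E × E → E}

lemma contDiffAt (h : FlatConcurrent Ω F S φ) {q : E × E} (hq : q ∈ Ω) : ContDiffAt ℝ ∞ F q :=
  h.smooth.contDiffAt (h.spray.isOpen.mem_nhds hq)

lemma contDiffAt_field (h : FlatConcurrent Ω F S φ) {q : E × E} (hq : q ∈ Ω) :
    ContDiffAt ℝ ∞ φ q :=
  h.smooth_field.contDiffAt (h.spray.isOpen.mem_nhds hq)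

lemma differentiableAt (h : FlatConcurrent Ω F S φ) {q : E × E} (hq : q ∈ Ω) :
    DifferentiableAt ℝ F q :=
  (h.contDiffAt hq).differentiableAt (by simp)

lemma differentiableAt_field (h : FlatConcurrent Ω F S φ) {q : E × E} (hq : q ∈ Ω) :
    DifferentiableAt ℝ φ q :=
  (h.contDiffAt_field hq).differentiableAt (by simp)

lemma fderiv_energy (h : FlatConcurrent Ω F S φ) {q : E × E} (hq : q ∈ Ω) (ξ : E × E) :
    fderiv ℝ (flatEnergy F) q ξ = F q * fderiv ℝ F q ξ := by
  have h1 := ((h.differentiableAt hq).hasFDerivAt.pow 2).const_mul (1 / 2 : ℝ)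
  refine (DFunLike.congr_fun h1.fderiv ξ).trans ?_
  simp
  ring

/-- At a zero of F the differential F dF of the energy vanishes, hence so does S; but the first
component of S is y ≠ 0. -/
lemma ne_zero (h : FlatConcurrent Ω F S φ) {q : E × E} (hq : q ∈ Ω) : F q ≠ 0 := by
  intro h0
  have h1 : S q = 0 := h.spray.nondegenerate q hq _ fun ζ => by
    rw [h.spray.spray q hq, h.fderiv_energy hq, h0, zero_mul, neg_zero]
  apply h.snd_ne q hq
  rw [← h.spray.fst_eq hq, h1, Prod.fst_zero]

lemma contDiffAt_metric (h : FlatConcurrent Ω F S φ) {q : E × E} (hq : q ∈ Ω)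
    {w z : E × E → E} (hw : ContDiffAt ℝ ∞ w q) (hz : ContDiffAt ℝ ∞ z q) :
    ContDiffAt ℝ ∞ (fun r => flatMetric (flatEnergy F) r (w r) (z r)) q :=
  ((h.spray.contDiffAt_fderiv_fderiv hq).clm_apply (contDiffAt_const.prodMk hw)).clm_apply
    (contDiffAt_const.prodMk hz)

lemma metric_snd (h : FlatConcurrent Ω F S φ) {q : E × E} (hq : q ∈ Ω) (w : E) :
    flatMetric (flatEnergy F) q w q.2 = fderiv ℝ (flatEnergy F) q (0, w) := by
  have := h.spray.euler_fderiv hq (0, w)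
  rw [flatMetric]
  linarith

lemma fderiv_zero_prod (h : FlatConcurrent Ω F S φ) {q : E × E} (hq : q ∈ Ω) (ξ : E × E) :
    fderiv ℝ (fun r => ((0 : E), φ r)) q ξ = (0, fderiv ℝ φ q ξ) := by
  rw [((hasFDerivAt_const (0 : E) q).prodMk (h.differentiableAt_field hq).hasFDerivAt).fderiv]
  rfl

/-- The function `Φ = g(φ, η)`. -/
def phiFun (F : E × E → ℝ) (φ : E × E → E) (q : E × E) : ℝ := flatMetric (flatEnergy F) q (φ q) q.2

/-- The function `p² = g(φ, φ)`. -/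
def sqFun (F : E × E → ℝ) (φ : E × E → E) (q : E × E) : ℝ := flatMetric (flatEnergy F) q (φ q) (φ q)

lemma contDiffAt_phiFun (h : FlatConcurrent Ω F S φ) {q : E × E} (hq : q ∈ Ω) :
    ContDiffAt ℝ ∞ (phiFun F φ) q :=
  h.contDiffAt_metric hq (h.contDiffAt_field hq) contDiffAt_snd

lemma contDiffAt_sqFun (h : FlatConcurrent Ω F S φ) {q : E × E} (hq : q ∈ Ω) :
    ContDiffAt ℝ ∞ (sqFun F φ) q :=
  h.contDiffAt_metric hq (h.contDiffAt_field hq) (h.contDiffAt_field hq)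

/-- By Euler, Φ involves only the first derivative of the energy, so that dΦ needs no third
derivatives. -/
lemma phiFun_eq (h : FlatConcurrent Ω F S φ) {q : E × E} (hq : q ∈ Ω) :
    phiFun F φ q = fderiv ℝ (flatEnergy F) q (0, φ q) :=
  h.metric_snd hq _

lemma fderiv_phiFun (h : FlatConcurrent Ω F S φ) {q : E × E} (hq : q ∈ Ω) (ξ : E × E) :
    fderiv ℝ (phiFun F φ) q ξ
      = fderiv ℝ (fderiv ℝ (flatEnergy F)) q ξ (0, φ q) + fderiv ℝ (flatEnergy F) q (0, fderiv ℝ φ q ξ) := by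
  have h1 : phiFun F φ =ᶠ[𝓝 q] fun r => fderiv ℝ (flatEnergy F) r (0, φ r) := by
    filter_upwards [h.spray.eventually_mem hq] with r hr using h.phiFun_eq hr
  have hφ := h.differentiableAt_field hq
  rw [h1.fderiv_eq, fderiv_clm_apply_apply (h.spray.differentiableAt_fderiv hq) (by fun_prop),
    h.fderiv_zero_prod hq]

lemma fderiv_phiFun_vertical (h : FlatConcurrent Ω F S φ) {q : E × E} (hq : q ∈ Ω) (w : E) :
    fderiv ℝ (phiFun F φ) q (0, w) = fderiv ℝ (fderiv ℝ (flatEnergy F)) q (0, w) (0, φ q) := by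
  have h4 : ((0 : E), (0 : E)) = 0 := rfl
  rw [h.fderiv_phiFun hq, h.vertical q hq, h4, map_zero, add_zero]

lemma fderiv_phiFun_field (h : FlatConcurrent Ω F S φ) {q : E × E} (hq : q ∈ Ω) :
    fderiv ℝ (phiFun F φ) q (0, φ q) = sqFun F φ q :=
  h.fderiv_phiFun_vertical hq _

lemma fderiv_field (h : FlatConcurrent Ω F S φ) {q : E × E} (hq : q ∈ Ω) :
    fderiv ℝ F q (0, φ q) = phiFun F φ q / F q := by
  rw [eq_div_iff (h.ne_zero hq), h.phiFun_eq hq, h.fderiv_energy hq, mul_comm]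

/-- In g(φ, φ) the second φ is constant along the fibres, so it may be frozen; the condition
`cartan` then applies with z = φ q. -/
lemma fderiv_sqFun_vertical (h : FlatConcurrent Ω F S φ) {q : E × E} (hq : q ∈ Ω) (w : E) :
    fderiv ℝ (sqFun F φ) q (0, w) = 0 := by
  have hφ := h.differentiableAt_field hq
  have h2 := (h.spray.contDiffAt_fderiv_fderiv hq).differentiableAt (by simp)
  have hc : DifferentiableAt ℝ (fun r => fderiv ℝ (fderiv ℝ (flatEnergy F)) r (0, φ r)) q :=
    h2.clm_apply (by fun_prop)
  have h3 := fderiv_clm_apply_apply hc (w := fun r => ((0 : E), φ r)) (by fun_prop) (0, w)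
  have h4 : ((0 : E), (0 : E)) = 0 := rfl
  rw [h.fderiv_zero_prod hq, h.vertical q hq, h4, map_zero, add_zero,
    ← fderiv_apply_const hc] at h3
  exact h3.trans (h.cartan q hq w (φ q))

section FiniteDimensional

variable [FiniteDimensional ℝ E]

/-- Differentiate dL(hor w) = 0 along (0, φ): this produces D²L((0, φ), hor w) and half the second
vertical derivative of S. The latter is also the correction term in D°_{βw} φ = -w, so the two
occurrences cancel and only -dL(0, w) is left. -/
lemma fderiv_phiFun_hor (h : FlatConcurrent Ω F S φ) {q : E × E} (hq : q ∈ Ω) (w : E) :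
    fderiv ℝ (phiFun F φ) q (FlatSpray.hor S q w) = -(F q * fderiv ℝ F q (0, w)) := by
  have hS := h.spray.contDiffAt_spray hq
  have hS1 : DifferentiableAt ℝ (fderiv ℝ S) q :=
    (hS.fderiv_right (m := ∞) (by simp)).differentiableAt (by simp)
  have h1 : (fun r => fderiv ℝ (flatEnergy F) r (FlatSpray.hor S r w)) =ᶠ[𝓝 q] fun _ => 0 := by
    filter_upwards [h.spray.eventually_mem hq] with r hr using h.spray.fderiv_hor hr w
  have h2 := DFunLike.congr_fun (h1.fderiv_eq (𝕜 := ℝ)) (0, φ q)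
  have hS2 : HasFDerivAt (fun r => fderiv ℝ S r (0, w))
      ((fderiv ℝ (fderiv ℝ S) q).flip (0, w)) q := by
    simpa using hS1.hasFDerivAt.clm_apply (hasFDerivAt_const ((0 : E), w) q)
  have hh : HasFDerivAt (fun r => FlatSpray.hor S r w) ((0 : E × E →L[ℝ] E).prod
      ((1 / 2 : ℝ) • ((ContinuousLinearMap.snd ℝ E E).comp
        ((fderiv ℝ (fderiv ℝ S) q).flip (0, w))))) q :=
    (hasFDerivAt_const w q).prodMk ((hS2.snd).const_smul (1 / 2 : ℝ))
  rw [fderiv_clm_apply_apply (h.spray.differentiableAt_fderiv hq) hh.differentiableAt,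
    hh.fderiv] at h2
  have h3 : fderiv ℝ (fun _ : E × E => (0 : ℝ)) q (0, φ q) = 0 := by simp
  rw [h3] at h2
  rw [h.fderiv_phiFun hq, h.spray.symm hq, ← h.fderiv_energy hq,
    ← sub_add_cancel (fderiv ℝ φ q _) ((1 / 2 : ℝ) • (fderiv ℝ (fderiv ℝ S) q (0, φ q) (0, w)).2),
    h.horizontal q hq]
  have h5 : ((0 : E), -w + (1 / 2 : ℝ) • (fderiv ℝ (fderiv ℝ S) q (0, φ q) (0, w)).2)
      = (0, (1 / 2 : ℝ) • (fderiv ℝ (fderiv ℝ S) q (0, φ q) (0, w)).2) - (0, w) := by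
    simp [sub_eq_neg_add]
  rw [h5, map_sub]
  have h6 : ((0 : E × E →L[ℝ] E).prod ((1 / 2 : ℝ) • ((ContinuousLinearMap.snd ℝ E E).comp
        ((fderiv ℝ (fderiv ℝ S) q).flip (0, w))))) (0, φ q)
      = (0, (1 / 2 : ℝ) • (fderiv ℝ (fderiv ℝ S) q (0, φ q) (0, w)).2) := rfl
  rw [h6] at h2
  linarith

lemma fderiv_hor (h : FlatConcurrent Ω F S φ) {q : E × E} (hq : q ∈ Ω) (w : E) :
    fderiv ℝ F q (FlatSpray.hor S q w) = 0 := by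
  have := h.spray.fderiv_hor hq w
  rw [h.fderiv_energy hq] at this
  exact (mul_eq_zero.1 this).resolve_left (h.ne_zero hq)

omit [FiniteDimensional ℝ E] in
lemma fderiv_snd_eq (h : FlatConcurrent Ω F S φ) {q : E × E} (hq : q ∈ Ω) :
    fderiv ℝ F q (0, q.2) = F q := by
  have h1 := h.spray.euler hq
  rw [h.fderiv_energy hq] at h1
  have h0 := h.ne_zero hq
  apply mul_left_cancel₀ h0
  simp only [flatEnergy] at h1
  linarith

lemma fderiv_phiFun_spray (h : FlatConcurrent Ω F S φ) {q : E × E} (hq : q ∈ Ω) :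
    fderiv ℝ (phiFun F φ) q (S q) = -F q ^ 2 := by
  rw [← h.spray.hor_snd hq, h.fderiv_phiFun_hor hq, h.fderiv_snd_eq hq, pow_two]

end FiniteDimensional

/-- The changed metric `F² / (F - Φ)`. -/
def hat (F : E × E → ℝ) (φ : E × E → E) (q : E × E) : ℝ := F q ^ 2 / (F q - phiFun F φ q)

/-- The denominator `F (1 + 2 p²) - 3 Φ`. -/
def denom (F : E × E → ℝ) (φ : E × E → E) (q : E × E) : ℝ :=
  F q * (1 + 2 * sqFun F φ q) - 3 * phiFun F φ q

/-- The coefficient `f₁` in coordinates. -/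
def coef₁ (F : E × E → ℝ) (φ : E × E → E) (q : E × E) : ℝ :=
  F q * (4 * phiFun F φ q - F q) / denom F φ q

/-- The coefficient `f₂` in coordinates. -/
def coef₂ (F : E × E → ℝ) (φ : E × E → E) (q : E × E) : ℝ :=
  2 * F q ^ 3 / denom F φ q

lemma contDiffAt_denom (h : FlatConcurrent Ω F S φ) {q : E × E} (hq : q ∈ Ω) :
    ContDiffAt ℝ ∞ (denom F φ) q :=
  ((h.contDiffAt hq).mul (contDiffAt_const.add (contDiffAt_const.mul (h.contDiffAt_sqFun hq)))).sub
    (contDiffAt_const.mul (h.contDiffAt_phiFun hq))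

lemma contDiffAt_coef₁ (h : FlatConcurrent Ω F S φ) {q : E × E} (hq : q ∈ Ω)
    (hd : denom F φ q ≠ 0) : ContDiffAt ℝ ∞ (coef₁ F φ) q :=
  ((h.contDiffAt hq).mul
    ((contDiffAt_const.mul (h.contDiffAt_phiFun hq)).sub (h.contDiffAt hq))).div
    (h.contDiffAt_denom hq) hd

lemma contDiffAt_coef₂ (h : FlatConcurrent Ω F S φ) {q : E × E} (hq : q ∈ Ω)
    (hd : denom F φ q ≠ 0) : ContDiffAt ℝ ∞ (coef₂ F φ) q :=
  (contDiffAt_const.mul ((h.contDiffAt hq).pow 3)).div (h.contDiffAt_denom hq) hd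

variable {Ω' : Set (E × E)} {S' : E × E → E × E}

lemma fderiv_energy_hat (h : FlatConcurrent Ω F S φ) {q : E × E} (hq : q ∈ Ω)
    (hD : F q - phiFun F φ q ≠ 0) (ξ : E × E) :
    fderiv ℝ (flatEnergy (hat F φ)) q ξ
      = F q ^ 3 * (F q - 2 * phiFun F φ q) / (F q - phiFun F φ q) ^ 3 * fderiv ℝ F q ξ
        + F q ^ 4 / (F q - phiFun F φ q) ^ 3 * fderiv ℝ (phiFun F φ) q ξ := by
  have hF := h.differentiableAt hq
  have hΦ := (h.contDiffAt_phiFun hq).differentiableAt (by simp)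
  have hF1 := hasDerivAt_line hF ξ
  have hΦ1 := hasDerivAt_line hΦ ξ
  have e : q + (0 : ℝ) • ξ = q := by simp
  refine fderiv_eq_of_line ?_ ?_
  · unfold flatEnergy hat
    fun_prop (disch := exact hD)
  · have := (((hF1.fun_pow 2).fun_div (hF1.fun_sub hΦ1)
      (by simp only [e]; exact hD)).fun_pow 2).const_mul (1 / 2 : ℝ)
    refine this.congr_deriv ?_
    simp only [e, Nat.add_one_sub_one, pow_one, Nat.cast_ofNat]
    field_simp
    ring

section Spray

variable [FiniteDimensional ℝ E]

/-- The spray of the changed metric. -/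
lemma spray_hat (h : FlatConcurrent Ω F S φ)
    (h' : FlatSpray Ω' (flatEnergy (hat F φ)) S') (hΩ : Ω' ⊆ Ω)
    (hD : ∀ q ∈ Ω', F q - phiFun F φ q ≠ 0) (hd : ∀ q ∈ Ω', denom F φ q ≠ 0)
    {q : E × E} (hq : q ∈ Ω') :
    S' q = S q + (0, coef₂ F φ q • φ q - coef₁ F φ q • q.2) := by
  have hqΩ := hΩ hq
  have hF := h.differentiableAt hqΩ
  have hΦ := (h.contDiffAt_phiFun hqΩ).differentiableAt (by simp)
  have hP := (h.contDiffAt_sqFun hqΩ).differentiableAt (by simp)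
  have hφ := h.differentiableAt_field hqΩ
  have hS := (h.spray.contDiffAt_spray hqΩ).differentiableAt (by simp)
  have hL := h'.differentiableAt_fderiv hq
  have hF0 := h.ne_zero hqΩ
  have hDq := hD q hq
  have hdq := hd q hq
  set L' : E × E → ℝ := flatEnergy (hat F φ)
  -- The Euler-Lagrange form of the spray equation. The summands S, φ and y of the candidate are
  -- treated in turn: the Hessian of L' against S and φ comes from differentiating dL'(S) and dL'(0,
  -- φ) along (0, w), the one against y from Euler.
  have key : ∀ w : E, fderiv ℝ (fderiv ℝ L') q (S q + (0, coef₂ F φ q • φ q - coef₁ F φ q • q.2))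
      (0, w) = fderiv ℝ L' q (w, 0) := by
    intro w
    have e : q + (0 : ℝ) • ((0 : E), w) = q := by simp
    have hF1 := hasDerivAt_line hF (0, w)
    have hΦ1 := hasDerivAt_line hΦ (0, w)
    have hP1 := hasDerivAt_line hP (0, w)
    rw [h.fderiv_sqFun_vertical hqΩ] at hP1
    obtain ⟨a, ha⟩ : ∃ a, fderiv ℝ F q (0, w) = a := ⟨_, rfl⟩
    obtain ⟨b, hb⟩ : ∃ b, fderiv ℝ (phiFun F φ) q (0, w) = b := ⟨_, rfl⟩
    rw [ha] at hF1
    rw [hb] at hΦ1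
    -- the derivative of `dL'(S)` along `(0, w)`
    have s1 : (fun r => fderiv ℝ L' r (S r)) =ᶠ[𝓝 q]
        fun r => -(F r ^ 6 / (F r - phiFun F φ r) ^ 3) := by
      filter_upwards [h'.eventually_mem hq] with r hr
      have h1 := h.fderiv_hor (hΩ hr) r.2
      rw [h.spray.hor_snd (hΩ hr)] at h1
      rw [h.fderiv_energy_hat (hΩ hr) (hD r hr), h.fderiv_phiFun_spray (hΩ hr), h1]
      ring
    have s2 := DFunLike.congr_fun (s1.fderiv_eq (𝕜 := ℝ)) (0, w)
    rw [fderiv_clm_apply_apply hL hS, h'.symm hq] at s2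
    have s3 : fderiv ℝ (fun r => -(F r ^ 6 / (F r - phiFun F φ r) ^ 3)) q (0, w)
        = -(6 * F q ^ 5 * a / (F q - phiFun F φ q) ^ 3
          - 3 * F q ^ 6 * (a - b) / (F q - phiFun F φ q) ^ 4) := by
      refine fderiv_eq_of_line ?_ ?_
      · fun_prop (disch := exact pow_ne_zero 3 hDq)
      · have := ((hF1.fun_pow 6).fun_div ((hF1.fun_sub hΦ1).fun_pow 3)
          (by simp only [e]; exact pow_ne_zero 3 hDq)).fun_neg
        refine this.congr_deriv ?_
        simp only [e]
        field_simp
        ring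
    have s4 : fderiv ℝ S q (0, w) = (2 : ℝ) • FlatSpray.hor S q w - (w, 0) := by
      ext
      · simp [FlatSpray.hor, h.spray.fderiv_spray_fst hqΩ, two_smul]
      · simp [FlatSpray.hor]
    have s5 : fderiv ℝ L' q (FlatSpray.hor S q w)
        = -(F q ^ 5 / (F q - phiFun F φ q) ^ 3 * a) := by
      rw [h.fderiv_energy_hat hqΩ hDq, h.fderiv_hor hqΩ, h.fderiv_phiFun_hor hqΩ, ha]
      ring
    rw [s3, s4, map_sub, map_smul, s5, smul_eq_mul] at s2
    -- the derivative of `dL'(φ)` along `(0, w)`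
    have t1 : (fun r => fderiv ℝ L' r (0, φ r)) =ᶠ[𝓝 q]
        fun r => (F r ^ 2 * (F r - 2 * phiFun F φ r) * phiFun F φ r + F r ^ 4 * sqFun F φ r)
          / (F r - phiFun F φ r) ^ 3 := by
      filter_upwards [h'.eventually_mem hq] with r hr
      have h0 := h.ne_zero (hΩ hr)
      have h1 := hD r hr
      rw [h.fderiv_energy_hat (hΩ hr) (hD r hr), h.fderiv_field (hΩ hr),
        h.fderiv_phiFun_field (hΩ hr)]
      field_simp
    have t2 := DFunLike.congr_fun (t1.fderiv_eq (𝕜 := ℝ)) (0, w)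
    have h4 : ((0 : E), (0 : E)) = 0 := rfl
    rw [fderiv_clm_apply_apply hL (by fun_prop), h.fderiv_zero_prod hqΩ, h.vertical q hqΩ, h4,
      map_zero, add_zero, h'.symm hq] at t2
    have t3 : fderiv ℝ (fun r => (F r ^ 2 * (F r - 2 * phiFun F φ r) * phiFun F φ r
          + F r ^ 4 * sqFun F φ r) / (F r - phiFun F φ r) ^ 3) q (0, w)
        = ((2 * F q * a * (F q - 2 * phiFun F φ q) * phiFun F φ q
            + F q ^ 2 * (a - 2 * b) * phiFun F φ q + F q ^ 2 * (F q - 2 * phiFun F φ q) * b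
            + 4 * F q ^ 3 * a * sqFun F φ q) * (F q - phiFun F φ q)
          - 3 * (F q ^ 2 * (F q - 2 * phiFun F φ q) * phiFun F φ q + F q ^ 4 * sqFun F φ q)
            * (a - b)) / (F q - phiFun F φ q) ^ 4 := by
      refine fderiv_eq_of_line ?_ ?_
      · fun_prop (disch := exact pow_ne_zero 3 hDq)
      · have := ((((hF1.fun_pow 2).fun_mul (hF1.fun_sub (hΦ1.const_mul 2))).fun_mul hΦ1).fun_add
          ((hF1.fun_pow 4).fun_mul hP1)).fun_div ((hF1.fun_sub hΦ1).fun_pow 3)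
          (by simp only [e]; exact pow_ne_zero 3 hDq)
        refine this.congr_deriv ?_
        simp only [e]
        field_simp
        ring
    rw [t3] at t2
    -- the Euler relation
    have u1 := h'.euler_fderiv hq (0, w)
    rw [h.fderiv_energy_hat hqΩ hDq (0, w), ha, hb, h'.symm hq] at u1
    have e1 : S q + (0, coef₂ F φ q • φ q - coef₁ F φ q • q.2)
        = S q + coef₂ F φ q • ((0 : E), φ q) - coef₁ F φ q • ((0 : E), q.2) := by
      ext <;> simp [add_sub_assoc]
    rw [e1, map_sub, map_add, map_smul, map_smul]
    simp only [sub_apply, add_apply, smul_apply, smul_eq_mul]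
    have s2' := eq_sub_of_add_eq s2
    have u1' := eq_sub_of_add_eq u1
    rw [s2', t2, u1', coef₁, coef₂]
    have hN : denom F φ q = F q * (1 + 2 * sqFun F φ q) - 3 * phiFun F φ q := rfl
    -- The denominator stays an atom while fractions are cleared, where only N ≠ 0 matters; its
    -- value enters in the final polynomial identity.
    generalize fderiv ℝ L' q (w, 0) = c, denom F φ q = N, phiFun F φ q = P at *
    field_simp
    rw [hN]
    ring
  -- Since the candidate has first component y, Euler turns the remaining term of the form into
  -- first derivatives of L', and `key` yields the full spray equation.
  refine (h'.unique hq fun ζ => ?_).symm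
  have h1 := h'.euler_fderiv hq ζ
  have h2 : fderiv ℝ L' q ζ = fderiv ℝ L' q (ζ.1, 0) + fderiv ℝ L' q (0, ζ.2) := by
    rw [← map_add]; simp
  have h3 : (S q + (0, coef₂ F φ q • φ q - coef₁ F φ q • q.2)).1 = q.2 := by
    simp [h.spray.fst_eq hqΩ]
  rw [flatForm, key, h3]
  linarith

end Spray

end FlatConcurrent

end FlatMatsumoto

/-! ### The horizontal Berwald derivative in coordinates and its change. -/

section FlatBerwald

variable {E : Type*} [NormedAddCommGroup E] [NormedSpace ℝ E]

/-- The horizontal part of the Berwald connection in coordinates. -/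
def flatBerwald (S : E × E → E × E) (W Z : E × E → E) (q : E × E) : E :=
  fderiv ℝ Z q (FlatSpray.hor S q (W q))
    - (1 / 2 : ℝ) • (fderiv ℝ (fderiv ℝ S) q (0, Z q) (0, W q)).2

lemma flatForm_vertical (f : E × E → ℝ) (q : E × E) (z : E) (ζ : E × E) :
    flatForm f q (0, z) ζ = fderiv ℝ (fderiv ℝ f) q (0, z) (0, ζ.1) := by
  have h : ((0 : E), (0 : E)) = 0 := rfl
  simp [flatForm, h]

lemma hasFDerivAt_fderiv_apply {V G : Type*} [NormedAddCommGroup V] [NormedSpace ℝ V]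
    [NormedAddCommGroup G] [NormedSpace ℝ G] {f : V → G} {q : V} (hf : ContDiffAt ℝ ∞ f q)
    (ξ : V) : HasFDerivAt (fun r => fderiv ℝ f r ξ) ((fderiv ℝ (fderiv ℝ f) q).flip ξ) q := by
  have : DifferentiableAt ℝ (fderiv ℝ f) q :=
    (hf.fderiv_right (m := ∞) (by simp)).differentiableAt (by simp)
  simpa using this.hasFDerivAt.clm_apply (hasFDerivAt_const ξ q)

namespace FlatConcurrent

variable {Ω : Set (E × E)} {F : E × E → ℝ} {S : E × E → E × E} {φ : E × E → E}
  {Ω' : Set (E × E)} {S' : E × E → E × E} [FiniteDimensional ℝ E]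

lemma fderiv_spray_hat (h : FlatConcurrent Ω F S φ)
    (h' : FlatSpray Ω' (flatEnergy (hat F φ)) S') (hΩ : Ω' ⊆ Ω)
    (hD : ∀ q ∈ Ω', F q - phiFun F φ q ≠ 0) (hd : ∀ q ∈ Ω', denom F φ q ≠ 0)
    {q : E × E} (hq : q ∈ Ω') (w : E) :
    (fderiv ℝ S' q (0, w)).2 = (fderiv ℝ S q (0, w)).2
      + fderiv ℝ (coef₂ F φ) q (0, w) • φ q - fderiv ℝ (coef₁ F φ) q (0, w) • q.2
      - coef₁ F φ q • w := by
  have hS := (h.spray.contDiffAt_spray (hΩ hq)).differentiableAt (by simp)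
  have h1 := (h.contDiffAt_coef₁ (hΩ hq) (hd q hq)).differentiableAt (by simp)
  have h2 := (h.contDiffAt_coef₂ (hΩ hq) (hd q hq)).differentiableAt (by simp)
  have hφ := h.differentiableAt_field (hΩ hq)
  have e : S' =ᶠ[𝓝 q] fun r => S r + (0, coef₂ F φ r • φ r - coef₁ F φ r • r.2) := by
    filter_upwards [h'.eventually_mem hq] with r hr using h.spray_hat h' hΩ hD hd hr
  have hd' := hS.hasFDerivAt.add ((hasFDerivAt_const (0 : E) q).prodMk
    ((h2.hasFDerivAt.smul hφ.hasFDerivAt).sub (h1.hasFDerivAt.smul hasFDerivAt_snd)))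
  have hd'' := hd'.congr_of_eventuallyEq e
  rw [hd''.fderiv]
  simp [h.vertical q (hΩ hq)]
  abel

lemma fderiv_fderiv_spray_hat (h : FlatConcurrent Ω F S φ)
    (h' : FlatSpray Ω' (flatEnergy (hat F φ)) S') (hΩ : Ω' ⊆ Ω)
    (hD : ∀ q ∈ Ω', F q - phiFun F φ q ≠ 0) (hd : ∀ q ∈ Ω', denom F φ q ≠ 0)
    {q : E × E} (hq : q ∈ Ω') (z w : E) :
    (fderiv ℝ (fderiv ℝ S') q (0, z) (0, w)).2 = (fderiv ℝ (fderiv ℝ S) q (0, z) (0, w)).2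
      + fderiv ℝ (fderiv ℝ (coef₂ F φ)) q (0, z) (0, w) • φ q
      - fderiv ℝ (fderiv ℝ (coef₁ F φ)) q (0, z) (0, w) • q.2
      - fderiv ℝ (coef₁ F φ) q (0, w) • z - fderiv ℝ (coef₁ F φ) q (0, z) • w := by
  have hS := hasFDerivAt_fderiv_apply (h.spray.contDiffAt_spray (hΩ hq)) (0, w)
  have hS' := hasFDerivAt_fderiv_apply (h'.contDiffAt_spray hq) (0, w)
  have c1 := h.contDiffAt_coef₁ (hΩ hq) (hd q hq)
  have c2 := h.contDiffAt_coef₂ (hΩ hq) (hd q hq)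
  have hφ := h.differentiableAt_field (hΩ hq)
  have h1 := (c1.differentiableAt (by simp)).hasFDerivAt
  have e : (fun r => (fderiv ℝ S' r (0, w)).2) =ᶠ[𝓝 q] fun r => (fderiv ℝ S r (0, w)).2
      + fderiv ℝ (coef₂ F φ) r (0, w) • φ r - fderiv ℝ (coef₁ F φ) r (0, w) • r.2
      - coef₁ F φ r • w := by
    filter_upwards [h'.eventually_mem hq] with r hr using h.fderiv_spray_hat h' hΩ hD hd hr w
  have hd' := ((hS.snd.add ((hasFDerivAt_fderiv_apply c2 (0, w)).smul hφ.hasFDerivAt)).sub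
    ((hasFDerivAt_fderiv_apply c1 (0, w)).smul hasFDerivAt_snd)).sub (h1.smul_const w)
  have hd'' := hS'.snd.unique (hd'.congr_of_eventuallyEq e)
  have := DFunLike.congr_fun hd'' ((0 : E), z)
  simp [h.vertical q (hΩ hq)] at this
  rw [this]
  abel

/-- The horizontal Berwald derivative of the changed metric. -/
lemma flatBerwald_hat (h : FlatConcurrent Ω F S φ)
    (h' : FlatSpray Ω' (flatEnergy (hat F φ)) S') (hΩ : Ω' ⊆ Ω)
    (hD : ∀ q ∈ Ω', F q - phiFun F φ q ≠ 0) (hd : ∀ q ∈ Ω', denom F φ q ≠ 0)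
    {q : E × E} (hq : q ∈ Ω') (W Z : E × E → E) :
    flatBerwald S' W Z q = flatBerwald S W Z q
      - (1 / 2 : ℝ) • (coef₁ F φ q • fderiv ℝ Z q (0, W q)
          + fderiv ℝ (coef₁ F φ) q (0, W q) • fderiv ℝ Z q (0, q.2)
          - fderiv ℝ (coef₁ F φ) q (0, W q) • Z q - fderiv ℝ (coef₁ F φ) q (0, Z q) • W q
          - fderiv ℝ (coef₂ F φ) q (0, W q) • fderiv ℝ Z q (0, φ q))
      + (1 / 2 : ℝ) • (fderiv ℝ (fderiv ℝ (coef₁ F φ)) q (0, Z q) (0, W q) • q.2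
          - fderiv ℝ (fderiv ℝ (coef₂ F φ)) q (0, Z q) (0, W q) • φ q) := by
  -- The new horizontal lift differs from the old one by vertical vectors along W, y and φ; these
  -- produce the D°_γ terms. All other terms come from the second vertical derivative of S'.
  have e1 : FlatSpray.hor S' q (W q) = FlatSpray.hor S q (W q)
      - (1 / 2 : ℝ) • (coef₁ F φ q • ((0 : E), W q)
        + fderiv ℝ (coef₁ F φ) q (0, W q) • ((0 : E), q.2)
        - fderiv ℝ (coef₂ F φ) q (0, W q) • ((0 : E), φ q)) := by
    ext
    · simp [FlatSpray.hor]
    · simp only [FlatSpray.hor, h.fderiv_spray_hat h' hΩ hD hd hq, Prod.snd_sub, Prod.smul_snd,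
        Prod.snd_add]
      module
  rw [flatBerwald, flatBerwald, e1, h.fderiv_fderiv_spray_hat h' hΩ hD hd hq]
  simp only [map_sub, map_add, map_smul]
  module

end FlatConcurrent

end FlatBerwald

/-! ### Charts of the tangent bundle, coordinate expressions and Lie brackets. -/

section Charts

variable {E : Type*} [NormedAddCommGroup E] [NormedSpace ℝ E]
  {M : Type*} [TopologicalSpace M] [ChartedSpace E M] [IsManifold 𝓘(ℝ, E) ∞ M]

/-- The chart of `TM` centred at `c`. -/
abbrev chT (c : TM E M) : PartialEquiv (TM E M) (E × E) := extChartAt 𝓘(ℝ, E).tangent c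

/-- The derivative of the chart of `TM` centred at `c`. -/
def dT (c v : TM E M) : TangentSpace 𝓘(ℝ, E).tangent v →L[ℝ] E × E :=
  mfderiv 𝓘(ℝ, E).tangent 𝓘(ℝ, E × E) (chT c) v

/-- The derivative of the chart of `M` centred at `π c`, at `π v`. -/
def dB (c v : TM E M) : TangentSpace 𝓘(ℝ, E) v.proj →L[ℝ] E :=
  mfderiv 𝓘(ℝ, E) 𝓘(ℝ, E) (extChartAt 𝓘(ℝ, E) c.proj) v.proj

variable {c v : TM E M}

lemma mem_chT_source : v ∈ (chT c).source ↔ v.proj ∈ (chartAt E c.proj).source := by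
  simp [chT]

/-- The trivialisation used by the chart of `TM` is the derivative of the chart of M. -/
lemma chT_apply (hv : v ∈ (chT c).source) :
    chT c v = (extChartAt 𝓘(ℝ, E) c.proj v.proj, dB c v v.2) := by
  rw [mem_chT_source] at hv
  have h1 := TangentBundle.continuousLinearMapAt_trivializationAt (I := 𝓘(ℝ, E)) hv
  unfold dB
  rw [← h1]
  refine Prod.ext rfl ?_
  rw [Trivialization.continuousLinearMapAt_apply, Trivialization.linearMapAt_apply,
    if_pos (by simpa using hv)]
  rfl

lemma isOpen_chT_source : IsOpen (chT c).source := isOpen_extChartAt_source c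
lemma isOpen_chT_target : IsOpen (chT c).target := isOpen_extChartAt_target c

lemma mem_chT_target {q : E × E} : q ∈ (chT c).target ↔ q.1 ∈ (extChartAt 𝓘(ℝ, E) c.proj).target := by
  rw [chT, FiberBundle.extChartAt_target]
  simpa using fun h => (chartAt E c.proj).map_target h

lemma mdifferentiableAt_chT (hv : v ∈ (chT c).source) :
    MDifferentiableAt 𝓘(ℝ, E).tangent 𝓘(ℝ, E × E) (chT c) v := 
  mdifferentiableAt_extChartAt (by simpa using hv)

lemma hasMFDerivAt_chT (hv : v ∈ (chT c).source) :
    HasMFDerivAt 𝓘(ℝ, E).tangent 𝓘(ℝ, E × E) (chT c) v (dT c v) := 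
  (mdifferentiableAt_chT hv).hasMFDerivAt

lemma isInvertible_dT (hv : v ∈ (chT c).source) : (dT c v).IsInvertible :=
  isInvertible_mfderiv_extChartAt hv

lemma isInvertible_dB (hv : v ∈ (chT c).source) : (dB c v).IsInvertible :=
  isInvertible_mfderiv_extChartAt (by simpa [mem_chT_source] using hv)

lemma dT_fst (hv : v ∈ (chT c).source) (ξ : TangentSpace 𝓘(ℝ, E).tangent v) :
    (dT c v ξ).1 = dB c v (rho v ξ) := by
  have h1 : HasMFDerivAt 𝓘(ℝ, E).tangent 𝓘(ℝ, E) (fun w => (chT c w).1) v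
      ((ContinuousLinearMap.fst ℝ E E).comp (dT c v)) :=
    (ContinuousLinearMap.fst ℝ E E).hasMFDerivAt.comp v (hasMFDerivAt_chT hv)
  have hp : HasMFDerivAt 𝓘(ℝ, E).tangent 𝓘(ℝ, E) (fun w : TM E M => w.proj) v (rho v) :=
    ((contMDiffAt_proj (n := 1) (TangentSpace 𝓘(ℝ, E))).mdifferentiableAt (by simp)).hasMFDerivAt
  have hB : HasMFDerivAt 𝓘(ℝ, E) 𝓘(ℝ, E) (extChartAt 𝓘(ℝ, E) c.proj) v.proj (dB c v) :=
    (mdifferentiableAt_extChartAt (mem_chT_source.1 hv)).hasMFDerivAt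
  have h2 := hB.comp v hp
  have h3 := hasMFDerivAt_unique h1 h2
  exact DFunLike.congr_fun h3 ξ

/-- In the chart the inclusion of a fibre is affine, with a constant first component and the linear
map `dB c v` as second. -/
lemma dT_gam (hv : v ∈ (chT c).source) (w : TangentSpace 𝓘(ℝ, E) v.proj) :
    dT c v (gam v w) = (0, dB c v w) := by
  -- Naming the map and the point at the model types hides their dependence on v, so that ordinary
  -- calculus on E applies.
  obtain ⟨B, hB⟩ : ∃ B : E →L[ℝ] E, B = dB c v := ⟨_, rfl⟩
  obtain ⟨y, hy⟩ : ∃ y : E, y = v.2 := ⟨_, rfl⟩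
  have hs : ∀ w : E, fibreIncl v.proj w ∈ (chT c).source := fun w =>
    mem_chT_source.2 (mem_chT_source.1 hv)
  have h1 : ∀ w : E, chT c (fibreIncl v.proj w)
      = (extChartAt 𝓘(ℝ, E) c.proj v.proj, B w) := fun w => by
    rw [hB]; exact chT_apply (hs w)
  have h2 : ∀ w : E, fibreIncl v.proj w
      = (chT c).symm (extChartAt 𝓘(ℝ, E) c.proj v.proj, B w) := fun w => by
    rw [← h1, (chT c).left_inv (hs w)]
  have h3 : HasFDerivAt (fun w : E => (extChartAt 𝓘(ℝ, E) c.proj v.proj, B w))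
      ((0 : E →L[ℝ] E).prod B) y :=
    (hasFDerivAt_const _ _).prodMk B.hasFDerivAt
  have h4 : MDifferentiableAt 𝓘(ℝ, E) 𝓘(ℝ, E).tangent (fibreIncl (E := E) v.proj) y := by
    have h5 : MDifferentiableAt 𝓘(ℝ, E × E) 𝓘(ℝ, E).tangent (chT c).symm
        (extChartAt 𝓘(ℝ, E) c.proj v.proj, B y) := by
      rw [← h1]
      exact ((contMDiffOn_extChartAt_symm (n := ∞) c).contMDiffAt (isOpen_chT_target.mem_nhds
        ((chT c).map_source (hs _)))).mdifferentiableAt (by simp)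
    have h6 := h5.comp y h3.differentiableAt.mdifferentiableAt
    exact h6.congr_of_eventuallyEq (.of_forall h2)
  have h7 := (hasMFDerivAt_chT (hs y)).comp y h4.hasMFDerivAt
  have h8 := hasMFDerivAt_unique
    (h7.congr_of_eventuallyEq (.of_forall fun w => (h1 w).symm)) h3.hasMFDerivAt
  subst hB hy
  exact DFunLike.congr_fun h8 w

/-- The coordinate expression of a function on `TM`. -/
def repF (c : TM E M) (f : TM E M → ℝ) (q : E × E) : ℝ := f ((chT c).symm q)

/-- The coordinate expression of a vector field on `TM`. -/
def repV (c : TM E M) (X : VField E M) (q : E × E) : E × E :=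
  dT c ((chT c).symm q) (X ((chT c).symm q))

/-- The coordinate expression of a `π`-vector field. -/
def repP (c : TM E M) (Z : PiField E M) (q : E × E) : E :=
  dB c ((chT c).symm q) (Z ((chT c).symm q))

lemma repF_chT (hv : v ∈ (chT c).source) (f : TM E M → ℝ) : repF c f (chT c v) = f v := by
  rw [repF, (chT c).left_inv hv]

lemma repV_chT (hv : v ∈ (chT c).source) (X : VField E M) :
    repV c X (chT c v) = dT c v (X v) := by
  rw [repV, (chT c).left_inv hv]

lemma repP_chT (hv : v ∈ (chT c).source) (Z : PiField E M) :
    repP c Z (chT c v) = dB c v (Z v) := by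
  rw [repP, (chT c).left_inv hv]

lemma repV_gamF {q : E × E} (hq : q ∈ (chT c).target) (Z : PiField E M) :
    repV c (gamF Z) q = (0, repP c Z q) :=
  dT_gam ((chT c).map_target hq) _

lemma repP_eta {q : E × E} (hq : q ∈ (chT c).target) : repP c eta q = q.2 := by
  have := congrArg Prod.snd (chT_apply ((chT c).map_target hq))
  rw [(chT c).right_inv hq] at this
  exact this.symm

lemma contMDiffAt_chT_symm {q : E × E} (hq : q ∈ (chT c).target) :
    ContMDiffAt 𝓘(ℝ, E × E) 𝓘(ℝ, E).tangent ∞ (chT c).symm q :=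
  (contMDiffOn_extChartAt_symm (n := ∞) c).contMDiffAt (isOpen_chT_target.mem_nhds hq)

lemma contMDiffAt_chT (hv : v ∈ (chT c).source) :
    ContMDiffAt 𝓘(ℝ, E).tangent 𝓘(ℝ, E × E) ∞ (chT c) v :=
  contMDiffAt_extChartAt' (by simpa using hv)

lemma contDiffAt_repF {q : E × E} (hq : q ∈ (chT c).target) {f : TM E M → ℝ}
    {A : Set (TM E M)} (hA : IsOpen A) (hf : SmoothFun f A) (hqA : (chT c).symm q ∈ A) :
    ContDiffAt ℝ ∞ (repF c f) q :=
  ((hf.contMDiffAt (hA.mem_nhds hqA)).comp q (contMDiffAt_chT_symm hq)).contDiffAt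

lemma contDiffAt_repP {q : E × E} (hq : q ∈ (chT c).target) {Z : PiField E M}
    {A : Set (TM E M)} (hA : IsOpen A) (hZ : SmoothPi Z A) (hqA : (chT c).symm q ∈ A) :
    ContDiffAt ℝ ∞ (repP c Z) q := by
  have h1 := (hZ.contMDiffAt (hA.mem_nhds hqA)).comp q (contMDiffAt_chT_symm hq)
  have hs : (⟨((chT c).symm q).proj, Z ((chT c).symm q)⟩ : TM E M) ∈ (chT c).source :=
    mem_chT_source.2 (mem_chT_source.1 ((chT c).map_target hq))
  have h2 := ((contMDiffAt_chT hs).comp q h1).contDiffAt.snd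
  refine h2.congr_of_eventuallyEq ?_
  filter_upwards [isOpen_chT_target.mem_nhds hq] with r hr
  have hs : (⟨((chT c).symm r).proj, Z ((chT c).symm r)⟩ : TM E M) ∈ (chT c).source :=
    mem_chT_source.2 (mem_chT_source.1 ((chT c).map_target hr))
  exact (congrArg Prod.snd (chT_apply hs)).symm

lemma df_apply (hv : v ∈ (chT c).source) {f : TM E M → ℝ}
    (hf : DifferentiableAt ℝ (repF c f) (chT c v)) (ξ : TangentSpace 𝓘(ℝ, E).tangent v) :
    df f v ξ = fderiv ℝ (repF c f) (chT c v) (dT c v ξ) := by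
  have h1 := hf.hasFDerivAt.hasMFDerivAt.comp v (hasMFDerivAt_chT hv)
  have h2 : f =ᶠ[𝓝 v] repF c f ∘ chT c := by
    filter_upwards [isOpen_chT_source.mem_nhds hv] with w hw using (repF_chT hw f).symm
  exact DFunLike.congr_fun (h1.congr_of_eventuallyEq h2).mfderiv ξ


/-- Near v the field X is the pullback of its coordinate expression along the chart, and pullbacks
by local diffeomorphisms preserve smoothness. -/
lemma contMDiffAt_of_repV [CompleteSpace E] (hv : v ∈ (chT c).source) {X : VField E M}
    (hX : ContDiffAt ℝ ∞ (repV c X) (chT c v)) :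
    ContMDiffAt 𝓘(ℝ, E).tangent 𝓘(ℝ, E).tangent.tangent ∞
      (fun w => (⟨w, X w⟩ : TangentBundle 𝓘(ℝ, E).tangent (TM E M))) v := by
  have h1 := ContMDiffAt.mpullback_vectorField_preimage (I := 𝓘(ℝ, E).tangent) (m := ∞) (n := ∞)
    (contMDiffAt_vectorSpace_iff_contDiffAt.2 hX) (contMDiffAt_chT hv) (isInvertible_dT hv) (by simp)
  refine h1.congr_of_eventuallyEq ?_
  filter_upwards [isOpen_chT_source.mem_nhds hv] with w hw
  have h2 : mpullback 𝓘(ℝ, E).tangent 𝓘(ℝ, E × E) (chT c) (repV c X) w = X w := by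
    change (dT c w).inverse (repV c X (chT c w)) = X w
    rw [repV_chT hw]
    obtain ⟨e, he⟩ := isInvertible_dT hw
    rw [← he]
    simp
  rw [h2]

lemma inverse_mfderiv_symm {q : E × E} (hq : q ∈ (chT c).target) :
    (mfderiv 𝓘(ℝ, E × E) 𝓘(ℝ, E).tangent (chT c).symm q).inverse = dT c ((chT c).symm q) := by
  have h1 := mfderivWithin_extChartAt_symm_comp_mfderiv_extChartAt hq
  have h2 := mfderiv_extChartAt_comp_mfderivWithin_extChartAt_symm hq
  rw [ModelWithCorners.Boundaryless.range_eq_univ, mfderivWithin_univ] at h1 h2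
  exact ContinuousLinearMap.inverse_eq h1 h2

lemma mpullback_symm {q : E × E} (hq : q ∈ (chT c).target) (X : VField E M) :
    mpullback 𝓘(ℝ, E × E) 𝓘(ℝ, E).tangent (chT c).symm X q = repV c X q :=
  DFunLike.congr_fun (inverse_mfderiv_symm hq) _

lemma isInvertible_mfderiv_symm {q : E × E} (hq : q ∈ (chT c).target) :
    (mfderiv 𝓘(ℝ, E × E) 𝓘(ℝ, E).tangent (chT c).symm q).IsInvertible := by
  have h := isInvertible_mfderivWithin_extChartAt_symm hq
  rwa [ModelWithCorners.Boundaryless.range_eq_univ, mfderivWithin_univ] at h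

lemma contDiffAt_repV [CompleteSpace E] {q : E × E} (hq : q ∈ (chT c).target) {X : VField E M}
    (hX : ContMDiffAt 𝓘(ℝ, E).tangent 𝓘(ℝ, E).tangent.tangent ∞
      (fun w => (⟨w, X w⟩ : TangentBundle 𝓘(ℝ, E).tangent (TM E M))) ((chT c).symm q)) :
    ContDiffAt ℝ ∞ (repV c X) q := by
  have h1 := ContMDiffAt.mpullback_vectorField_preimage (I := 𝓘(ℝ, E × E)) (m := ∞) (n := ∞)
    hX (contMDiffAt_chT_symm hq) (isInvertible_mfderiv_symm hq) (by simp)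
  refine (contMDiffAt_vectorSpace_iff_contDiffAt.1 h1).congr_of_eventuallyEq ?_
  filter_upwards [isOpen_chT_target.mem_nhds hq] with r hr using (mpullback_symm hr X).symm

lemma mlieBracket_eq_lieBracket {V : Type*} [NormedAddCommGroup V] [NormedSpace ℝ V]
    (X Y : ∀ x : V, TangentSpace 𝓘(ℝ, V) x) : mlieBracket 𝓘(ℝ, V) X Y = lieBracket ℝ X Y := by
  rw [← mlieBracketWithin_univ, mlieBracketWithin_eq_lieBracketWithin]
  exact lieBracketWithin_univ

/-- The bracket is natural under pullback by the inverse chart, and on a vector space it is the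
difference of directional derivatives. -/
lemma dT_bracket [CompleteSpace E] (hv : v ∈ (chT c).source) {X Y : VField E M}
    (hX : ContDiffAt ℝ ∞ (repV c X) (chT c v)) (hY : ContDiffAt ℝ ∞ (repV c Y) (chT c v)) :
    dT c v (bracket X Y v) = fderiv ℝ (repV c Y) (chT c v) (repV c X (chT c v))
      - fderiv ℝ (repV c X) (chT c v) (repV c Y (chT c v)) := by
  have hq := (chT c).map_source hv
  have hX' := (contMDiffAt_of_repV hv hX).mdifferentiableAt (by simp)
  have hY' := (contMDiffAt_of_repV hv hY).mdifferentiableAt (by simp)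
  rw [← (chT c).left_inv hv] at hX' hY'
  have : IsManifold 𝓘(ℝ, E).tangent (minSmoothness ℝ 2) (TM E M) := by
    rw [minSmoothness_of_isRCLikeNormedField]
    infer_instance
  have h1 := mpullback_mlieBracket (n := ∞) hX' hY' (contMDiffAt_chT_symm hq)
    (by simp [minSmoothness_of_isRCLikeNormedField]; exact ENat.LEInfty.out)
  have e : ∀ X : VField E M, mpullback 𝓘(ℝ, E × E) 𝓘(ℝ, E).tangent (chT c).symm X
      =ᶠ[𝓝 (chT c v)] repV c X := fun X => by
    filter_upwards [isOpen_chT_target.mem_nhds hq] with r hr using mpullback_symm hr X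
  rw [(e X).mlieBracket_vectorField_eq (e Y)] at h1
  rw [← repV_chT hv, ← mpullback_symm hq]
  refine h1.trans ?_
  exact congrFun (mlieBracket_eq_lieBracket _ _) _

end Charts

/-! ### Coordinate expressions of `dJ`, `ddJ`, the metric and the geodesic spray. -/

section Coordinates

variable {E : Type*} [NormedAddCommGroup E] [NormedSpace ℝ E]
  {M : Type*} [TopologicalSpace M] [ChartedSpace E M] [IsManifold 𝓘(ℝ, E) ∞ M]
  {c v : TM E M}

lemma dT_injective (hv : v ∈ (chT c).source) : Function.Injective (dT c v) :=
  (isInvertible_dT hv).injective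

lemma dB_injective (hv : v ∈ (chT c).source) : Function.Injective (dB c v) :=
  (isInvertible_dB hv).injective

lemma dT_vJ (hv : v ∈ (chT c).source) (ξ : TangentSpace 𝓘(ℝ, E).tangent v) :
    dT c v (vJ v ξ) = (0, (dT c v ξ).1) := by
  rw [dT_fst hv]
  exact dT_gam hv _

lemma rho_lift (w : TangentSpace 𝓘(ℝ, E) v.proj) : rho v (lift v w) = w := by
  have hv : v ∈ (chT v).source := mem_extChartAt_source v
  refine Function.invFun_eq ?_
  obtain ⟨ξ, hξ⟩ := (isInvertible_dT hv).surjective (dB v v w, 0)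
  refine ⟨ξ, dB_injective hv ?_⟩
  rw [← dT_fst hv, hξ]

lemma dT_lift_fst (hv : v ∈ (chT c).source) (w : TangentSpace 𝓘(ℝ, E) v.proj) :
    (dT c v (lift v w)).1 = dB c v w := by
  rw [dT_fst hv, rho_lift]

lemma dB_gamInv (hv : v ∈ (chT c).source) {ξ : TangentSpace 𝓘(ℝ, E).tangent v} {b : E}
    (hξ : dT c v ξ = (0, b)) : dB c v (gamInv v ξ) = b := by
  obtain ⟨w, rfl⟩ := (isInvertible_dB hv).surjective b
  have h1 : gam v (gamInv v ξ) = ξ :=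
    Function.invFun_eq ⟨w, dT_injective hv (by rw [dT_gam hv, hξ])⟩
  have h2 := dT_gam hv (gamInv v ξ)
  rw [h1, hξ] at h2
  exact (congrArg Prod.snd h2).symm

lemma extV_self (ξ : TangentSpace 𝓘(ℝ, E).tangent v) : extV ξ v = ξ :=
  FiberBundle.extend_apply_self (E × E) ξ

lemma contDiffAt_repV_extV [CompleteSpace E] (hv : v ∈ (chT c).source)
    (ξ : TangentSpace 𝓘(ℝ, E).tangent v) : ContDiffAt ℝ ∞ (repV c (extV ξ)) (chT c v) := by
  refine contDiffAt_repV ((chT c).map_source hv) ?_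
  rw [(chT c).left_inv hv]
  exact FiberBundle.contMDiffAt_extend 𝓘(ℝ, E).tangent (E × E) ξ

/-- Used for the test fields `extPi z`, which come from fields on M: their vertical derivatives
vanish. -/
lemma repP_congr_fst {q r : E × E} (hq : q ∈ (chT c).target) (hr : r ∈ (chT c).target)
    (hqr : q.1 = r.1) (Z : ∀ x : M, TangentSpace 𝓘(ℝ, E) x) :
    repP c (fun u => Z u.proj) q = repP c (fun u => Z u.proj) r := by
  have h : ((chT c).symm q).proj = ((chT c).symm r).proj := by
    have h1 := chT_apply ((chT c).map_target hq)
    have h2 := chT_apply ((chT c).map_target hr)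
    rw [(chT c).right_inv hq] at h1
    rw [(chT c).right_inv hr] at h2
    refine (extChartAt 𝓘(ℝ, E) c.proj).injOn ?_ ?_ ?_
    · simpa using mem_chT_source.1 ((chT c).map_target hq)
    · simpa using mem_chT_source.1 ((chT c).map_target hr)
    · exact (congrArg Prod.fst h1).symm.trans (hqr.trans (congrArg Prod.fst h2))
  exact congrArg
    (fun x : M => (mfderiv 𝓘(ℝ, E) 𝓘(ℝ, E) (extChartAt 𝓘(ℝ, E) c.proj) x (Z x) : E)) h

lemma exists_smoothPi_extPi (z : TangentSpace 𝓘(ℝ, E) v.proj) :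
    ∃ U : Set (TM E M), IsOpen U ∧ v ∈ U ∧ SmoothPi (extPi z) U := by
  obtain ⟨s, hs, h⟩ := FiberBundle.exists_contMDiffOn_extend (k := ∞) 𝓘(ℝ, E) E z
  obtain ⟨t, hts, ht, hvt⟩ := mem_nhds_iff.1 hs
  have hπ : ContMDiff 𝓘(ℝ, E).tangent 𝓘(ℝ, E) ∞ (fun u : TM E M => u.proj) :=
    contMDiff_proj (TangentSpace 𝓘(ℝ, E))
  exact ⟨(fun u : TM E M => u.proj) ⁻¹' t, ht.preimage hπ.continuous, hvt,
    (h.mono hts).comp hπ.contMDiffOn fun _ hu => hu⟩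

lemma contDiffAt_repP_extPi (hv : v ∈ (chT c).source) (z : TangentSpace 𝓘(ℝ, E) v.proj) :
    ContDiffAt ℝ ∞ (repP c (extPi z)) (chT c v) := by
  obtain ⟨U, hU, hvU, hz⟩ := exists_smoothPi_extPi z
  exact contDiffAt_repP ((chT c).map_source hv) hU hz (by rwa [(chT c).left_inv hv])

lemma extPi_self (z : TangentSpace 𝓘(ℝ, E) v.proj) : (extPi z : PiField E M) v = z :=
  FiberBundle.extend_apply_self E z

lemma fderiv_repP_extPi (hv : v ∈ (chT c).source) (z : TangentSpace 𝓘(ℝ, E) v.proj) (w : E) :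
    fderiv ℝ (repP c (extPi z)) (chT c v) (0, w) = 0 := by
  have hq := (chT c).map_source hv
  refine fderiv_eq_of_line ((contDiffAt_repP_extPi hv z).differentiableAt (by simp)) ?_
  have e : (fun t : ℝ => repP c (extPi z) (chT c v + t • ((0 : E), w)))
      = fun _ => repP c (extPi z) (chT c v) := by
    ext1 t
    refine repP_congr_fst ?_ hq (by simp) (fun x => FiberBundle.extend E z x)
    rw [mem_chT_target] at hq ⊢
    simpa using hq
  rw [e]
  exact hasDerivAt_const _ _

lemma dJ_apply (hv : v ∈ (chT c).source) {f : TM E M → ℝ}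
    (hf : DifferentiableAt ℝ (repF c f) (chT c v)) (ξ : TangentSpace 𝓘(ℝ, E).tangent v) :
    dJ f v ξ = fderiv ℝ (repF c f) (chT c v) (0, (dT c v ξ).1) := by
  rw [← dT_vJ hv, ← df_apply hv hf]
  rfl

lemma repF_dJ_eventuallyEq (hv : v ∈ (chT c).source) {f : TM E M → ℝ}
    (hf : ContDiffAt ℝ ∞ (repF c f) (chT c v)) (X : VField E M) :
    repF c (fun u => dJ f u (X u)) =ᶠ[𝓝 (chT c v)]
      fun q => fderiv ℝ (repF c f) q (0, (repV c X q).1) := by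
  have h1 : ∀ᶠ q in 𝓝 (chT c v), ContDiffAt ℝ 1 (repF c f) q :=
    (hf.of_le (m := 1) (by exact_mod_cast le_top)).eventually (by simp)
  filter_upwards [h1, isOpen_chT_target.mem_nhds ((chT c).map_source hv)] with q hq hqt
  have h := (chT c).right_inv hqt
  have h2 := dJ_apply ((chT c).map_target hqt) (f := f)
    (by rw [h]; exact hq.differentiableAt (by simp)) (X ((chT c).symm q))
  rw [h] at h2
  exact h2

/-- The derivatives of the chosen extensions enter the two differentiated terms and the bracket
term, and cancel. So the value depends only on ξ and ζ. -/
lemma ddJ_apply [CompleteSpace E] (hv : v ∈ (chT c).source) {f : TM E M → ℝ}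
    (hf : ContDiffAt ℝ ∞ (repF c f) (chT c v)) (ξ ζ : TangentSpace 𝓘(ℝ, E).tangent v) :
    ddJ f v ξ ζ = flatForm (repF c f) (chT c v) (dT c v ξ) (dT c v ζ) := by
  have hf1 := hf.differentiableAt (by simp)
  have hf2 : DifferentiableAt ℝ (fderiv ℝ (repF c f)) (chT c v) :=
    (hf.fderiv_right (m := ∞) (by simp)).differentiableAt (by simp)
  have key : ∀ ξ ζ : TangentSpace 𝓘(ℝ, E).tangent v,
      df (fun u => dJ f u (extV ζ u)) v ξ
        = fderiv ℝ (fderiv ℝ (repF c f)) (chT c v) (dT c v ξ) (0, (dT c v ζ).1)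
          + fderiv ℝ (repF c f) (chT c v)
            (0, (fderiv ℝ (repV c (extV ζ)) (chT c v) (dT c v ξ)).1) := by
    intro ξ ζ
    have e := repF_dJ_eventuallyEq hv hf (extV ζ)
    have hX := (contDiffAt_repV_extV hv ζ).differentiableAt (by simp)
    have hs : HasFDerivAt (fun q => shift (repV c (extV ζ) q))
        (shift.comp (fderiv ℝ (repV c (extV ζ)) (chT c v))) (chT c v) :=
      (shift (E := E)).hasFDerivAt.comp _ hX.hasFDerivAt
    have e' : repF c (fun u => dJ f u (extV ζ u)) =ᶠ[𝓝 (chT c v)]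
        fun q => fderiv ℝ (repF c f) q (shift (repV c (extV ζ) q)) := e
    rw [df_apply hv ((hf2.clm_apply hs.differentiableAt).congr_of_eventuallyEq e'), e'.fderiv_eq,
      fderiv_clm_apply_apply hf2 hs.differentiableAt, hs.fderiv, repV_chT hv, extV_self]
    rfl
  have hb := dT_bracket hv (contDiffAt_repV_extV hv ξ) (contDiffAt_repV_extV hv ζ)
  rw [repV_chT hv, repV_chT hv, extV_self, extV_self] at hb
  have e0 : ((0 : E), (fderiv ℝ (repV c (extV ζ)) (chT c v) (dT c v ξ)
      - fderiv ℝ (repV c (extV ξ)) (chT c v) (dT c v ζ)).1)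
      = (0, (fderiv ℝ (repV c (extV ζ)) (chT c v) (dT c v ξ)).1)
        - (0, (fderiv ℝ (repV c (extV ξ)) (chT c v) (dT c v ζ)).1) := by
    ext <;> simp
  rw [ddJ, extD, key, key, dJ_apply hv hf1, hb, e0, map_sub, flatForm]
  ring

lemma metric_apply [CompleteSpace E] (hv : v ∈ (chT c).source) {F : TM E M → ℝ}
    (hF : ContDiffAt ℝ ∞ (flatEnergy (repF c F)) (chT c v))
    (w z : TangentSpace 𝓘(ℝ, E) v.proj) :
    metric F v w z = flatMetric (flatEnergy (repF c F)) (chT c v) (dB c v w) (dB c v z) := by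
  rw [metric, ddJ_apply hv (f := energy F) hF, dT_gam hv]
  exact (flatForm_vertical _ _ _ _).trans (by rw [dT_lift_fst hv]; rfl)

/-- The part of a set of `TM` in the domain of the chart at `c`, in coordinates. -/
def repSet (c : TM E M) (A : Set (TM E M)) : Set (E × E) :=
  (chT c).target ∩ (chT c).symm ⁻¹' A

lemma isOpen_repSet {A : Set (TM E M)} (hA : IsOpen A) : IsOpen (repSet c A) :=
  (continuousOn_extChartAt_symm c).isOpen_inter_preimage isOpen_chT_target hA

lemma chT_mem_repSet {A : Set (TM E M)} (hv : v ∈ (chT c).source) (hvA : v ∈ A) :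
    chT c v ∈ repSet c A :=
  ⟨(chT c).map_source hv, by rwa [mem_preimage, (chT c).left_inv hv]⟩

/-- The chart is linear on fibres; this carries conicity and homogeneity over to coordinates. -/
lemma chT_symm_smul {q : E × E} (hq : q ∈ (chT c).target) (t : ℝ) :
    (chT c).symm (q.1, t • q.2)
      = (⟨((chT c).symm q).proj, t • ((chT c).symm q).2⟩ : TM E M) := by
  have hs := (chT c).map_target hq
  have hs' : (⟨((chT c).symm q).proj, t • ((chT c).symm q).2⟩ : TM E M) ∈ (chT c).source :=
    mem_chT_source.2 (mem_chT_source.1 hs)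
  have h1 := chT_apply hs
  rw [(chT c).right_inv hq] at h1
  have h2 := chT_apply hs'
  have h3 : chT c (⟨((chT c).symm q).proj, t • ((chT c).symm q).2⟩ : TM E M)
      = (q.1, t • q.2) := by
    rw [h2]
    exact Prod.ext (congrArg Prod.fst h1).symm
      (((dB c ((chT c).symm q)).map_smul t ((chT c).symm q).2).trans
        (congrArg (fun p => t • p.2) h1).symm)
  rw [← h3, (chT c).left_inv hs']

/-- `F` is smooth, homogeneous and nondegenerate on the open conic set `A`. -/
structure IsRegularOn (F : TM E M → ℝ) (A : Set (TM E M)) : Prop where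
  isOpen : IsOpen A
  smooth : SmoothFun F A
  scaling : ∀ x : M, ∀ y : TangentSpace 𝓘(ℝ, E) x, ∀ t : ℝ, 0 < t →
    (⟨x, y⟩ : TM E M) ∈ A → (⟨x, t • y⟩ : TM E M) ∈ A
  homogeneous : ∀ x : M, ∀ y : TangentSpace 𝓘(ℝ, E) x, ∀ t : ℝ, 0 < t →
    (⟨x, y⟩ : TM E M) ∈ A → F ⟨x, t • y⟩ = t * F ⟨x, y⟩
  maximalRank : MaximalRank F A

lemma IsConicPseudoFinsler.isRegularOn {F : TM E M → ℝ} {A : Set (TM E M)}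
    (h : IsConicPseudoFinsler A F) : IsRegularOn F A :=
  ⟨h.conic.isOpen, h.smooth, h.conic.scaling, h.homogeneous, h.maximalRank⟩

lemma mem_slit_iff (hv : v ∈ (chT c).source) : v ∈ slit E M ↔ (chT c v).2 ≠ 0 := by
  rw [chT_apply hv]
  exact ((map_ne_zero_iff (dB c v) (dB_injective hv))).symm

lemma isOpen_slit : IsOpen (slit E M) := by
  refine isOpen_iff_mem_nhds.2 fun u hu => ?_
  have hs : u ∈ (chT u).source := mem_extChartAt_source u
  have h1 : ContinuousAt (chT u) u := continuousAt_extChartAt u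
  have h2 : ∀ᶠ w in 𝓝 u, (chT u w).2 ≠ 0 :=
    (continuous_snd.continuousAt.comp h1).eventually_ne ((mem_slit_iff hs).1 hu)
  filter_upwards [h2, isOpen_chT_source.mem_nhds hs] with w hw hws using (mem_slit_iff hws).2 hw

lemma IsFinsler.isRegularOn {F : TM E M → ℝ} (h : IsFinsler F) : IsRegularOn F (slit E M) :=
  ⟨isOpen_slit, h.smooth, fun _ _ _ ht hy => smul_ne_zero ht.ne' hy,
    fun x y t ht _ => h.homogeneous x y t ht, h.maximalRank⟩

namespace IsRegularOn

variable {F : TM E M → ℝ} {A : Set (TM E M)}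

lemma contDiffAt_repF (h : IsRegularOn F A) {q : E × E} (hq : q ∈ repSet c A) :
    ContDiffAt ℝ ∞ (repF c F) q :=
  Finsler.contDiffAt_repF hq.1 h.isOpen h.smooth hq.2

lemma contDiffAt_energy (h : IsRegularOn F A) {q : E × E} (hq : q ∈ repSet c A) :
    ContDiffAt ℝ ∞ (flatEnergy (repF c F)) q :=
  contDiffAt_const.mul ((h.contDiffAt_repF hq).pow 2)

variable [CompleteSpace E]

lemma ddJ_energy (h : IsRegularOn F A) {q : E × E} (hq : q ∈ repSet c A)
    (ξ ζ : TangentSpace 𝓘(ℝ, E).tangent ((chT c).symm q)) :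
    ddJ (energy F) ((chT c).symm q) ξ ζ
      = flatForm (flatEnergy (repF c F)) q (dT c _ ξ) (dT c _ ζ) := by
  have h1 := ddJ_apply ((chT c).map_target hq.1) (f := energy F) (c := c)
    (by rw [(chT c).right_inv hq.1]; exact h.contDiffAt_energy hq) ξ ζ
  rw [(chT c).right_inv hq.1] at h1
  exact h1

omit [CompleteSpace E] in
lemma df_energy (h : IsRegularOn F A) {q : E × E} (hq : q ∈ repSet c A)
    (ξ : TangentSpace 𝓘(ℝ, E).tangent ((chT c).symm q)) :
    df (energy F) ((chT c).symm q) ξ = fderiv ℝ (flatEnergy (repF c F)) q (dT c _ ξ) := by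
  have h1 := df_apply ((chT c).map_target hq.1) (f := energy F) (c := c)
    (by rw [(chT c).right_inv hq.1]; exact (h.contDiffAt_energy hq).differentiableAt (by simp)) ξ
  rw [(chT c).right_inv hq.1] at h1
  exact h1

lemma flatRegular (h : IsRegularOn F A) (c : TM E M) :
    FlatRegular (repSet c A) (flatEnergy (repF c F)) where
  isOpen := isOpen_repSet h.isOpen
  smooth q hq := (h.contDiffAt_energy hq).contDiffWithinAt
  scaling q hq t ht := by
    refine ⟨mem_chT_target.2 (mem_chT_target.1 hq.1), ?_⟩
    rw [mem_preimage, chT_symm_smul hq.1]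
    exact h.scaling _ _ t ht hq.2
  homogeneous q hq t ht := by
    have := h.homogeneous ((chT c).symm q).proj ((chT c).symm q).2 t ht hq.2
    simp only [flatEnergy, repF, chT_symm_smul hq.1, this]
    ring
  nondegenerate q hq ξ hξ := by
    obtain ⟨ξ, rfl⟩ := (isInvertible_dT ((chT c).map_target hq.1)).surjective ξ
    rw [h.maximalRank _ hq.2 ξ fun ζ => by rw [h.ddJ_energy hq, hξ], map_zero]

lemma flatSpray [FiniteDimensional ℝ E] (h : IsRegularOn F A) (c : TM E M) :
    FlatSpray (repSet c A) (flatEnergy (repF c F)) (repV c (geodesicSpray F)) where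
  toFlatRegular := h.flatRegular c
  spray q hq ζ := by
    have hs := (chT c).map_target hq.1
    -- `geodesicSpray` is a choice, so a solution must be exhibited before its defining equation can
    -- be used.
    have ex : ∃ ξ, ∀ ζ, ddJ (energy F) ((chT c).symm q) ξ ζ
        = -df (energy F) ((chT c).symm q) ζ := by
      obtain ⟨η, hη⟩ := ((h.flatRegular c).flatFormL_isInvertible hq).surjective
        (-fderiv ℝ (flatEnergy (repF c F)) q)
      obtain ⟨ξ, rfl⟩ := (isInvertible_dT hs).surjective η
      refine ⟨ξ, fun ζ => ?_⟩
      rw [h.ddJ_energy hq, h.df_energy hq, ← (h.flatRegular c).flatFormL_apply hq, hη]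
      rfl
    obtain ⟨ζ, rfl⟩ := (isInvertible_dT hs).surjective ζ
    have h1 := Classical.epsilon_spec ex ζ
    rw [h.df_energy hq, h.ddJ_energy hq] at h1
    exact h1

end IsRegularOn

end Coordinates

/-! ### The Barthel and Berwald connections in coordinates. -/

section Connection

variable {E : Type*} [NormedAddCommGroup E] [NormedSpace ℝ E]
  {M : Type*} [TopologicalSpace M] [ChartedSpace E M] [IsManifold 𝓘(ℝ, E) ∞ M]
  {c v : TM E M} {F : TM E M → ℝ} {A : Set (TM E M)}

lemma repV_vJ {q : E × E} (hq : q ∈ (chT c).target) (X : VField E M) :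
    repV c (fun u => vJ u (X u)) q = (0, (repV c X q).1) :=
  dT_vJ ((chT c).map_target hq) _

lemma eventually_target (hv : v ∈ (chT c).source) : ∀ᶠ q in 𝓝 (chT c v), q ∈ (chT c).target :=
  isOpen_chT_target.mem_nhds ((chT c).map_source hv)

lemma eventually_repSet (hA : IsOpen A) (hv : v ∈ (chT c).source) (hvA : v ∈ A) :
    ∀ᶠ q in 𝓝 (chT c v), q ∈ repSet c A :=
  (isOpen_repSet hA).mem_nhds (chT_mem_repSet hv hvA)

lemma contDiffAt_repV_gamF (hv : v ∈ (chT c).source) {Z : PiField E M}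
    (hZ : ContDiffAt ℝ ∞ (repP c Z) (chT c v)) : ContDiffAt ℝ ∞ (repV c (gamF Z)) (chT c v) := by
  refine (contDiffAt_const.prodMk hZ : ContDiffAt ℝ ∞ (fun q => ((0 : E), repP c Z q)) _)
    |>.congr_of_eventuallyEq ?_
  filter_upwards [eventually_target hv] with q hq using repV_gamF hq Z

namespace IsRegularOn

variable [CompleteSpace E] [FiniteDimensional ℝ E]

/-- The spray of `F` in coordinates. -/
local notation "Sp[" F ", " c "]" => repV c (geodesicSpray F)

lemma contDiffAt_spray (h : IsRegularOn F A) (hv : v ∈ (chT c).source) (hvA : v ∈ A) :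
    ContDiffAt ℝ ∞ Sp[F, c] (chT c v) :=
  (h.flatSpray c).contDiffAt_spray (chT_mem_repSet hv hvA)

/-- The derivative along S of the extension of ξ occurs in both brackets and cancels; what remains
is the vertical derivative of the spray. -/
lemma dT_barthel (h : IsRegularOn F A) (hv : v ∈ (chT c).source) (hvA : v ∈ A)
    (ξ : TangentSpace 𝓘(ℝ, E).tangent v) :
    dT c v (barthel F v ξ) = ((dT c v ξ).1,
      (fderiv ℝ Sp[F, c] (chT c v) (0, (dT c v ξ).1)).2 - (dT c v ξ).2) := by
  have hq := chT_mem_repSet hv hvA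
  have hS := h.contDiffAt_spray hv hvA
  have hX := contDiffAt_repV_extV hv ξ
  have hX1 := hX.differentiableAt (by simp)
  have e : repV c (fun u => vJ u (extV ξ u)) =ᶠ[𝓝 (chT c v)]
      fun q => shift (repV c (extV ξ) q) := by
    filter_upwards [eventually_target hv] with q hq using repV_vJ hq _
  have hJ : ContDiffAt ℝ ∞ (repV c (fun u => vJ u (extV ξ u))) (chT c v) :=
    ((shift (E := E)).contDiff.contDiffAt.comp _ hX).congr_of_eventuallyEq e
  have hs : HasFDerivAt (fun q => shift (repV c (extV ξ) q))
      (shift.comp (fderiv ℝ (repV c (extV ξ)) (chT c v))) (chT c v) :=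
    (shift (E := E)).hasFDerivAt.comp _ hX1.hasFDerivAt
  rw [barthel, map_sub, dT_vJ hv, dT_bracket hv hJ hS, dT_bracket hv hX hS, e.fderiv_eq, hs.fderiv,
    e.eq_of_nhds, repV_chT hv, extV_self]
  have f1 := (h.flatSpray c).fderiv_spray_fst hq
  generalize fderiv ℝ Sp[F, c] (chT c v) = D at f1 ⊢
  ext
  · simp [f1]
  · simp [f1]

lemma dT_hproj (h : IsRegularOn F A) (hv : v ∈ (chT c).source) (hvA : v ∈ A)
    (ξ : TangentSpace 𝓘(ℝ, E).tangent v) :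
    dT c v (hproj F v ξ) = FlatSpray.hor Sp[F, c] (chT c v) (dT c v ξ).1 := by
  rw [hproj, map_smul, map_add, h.dT_barthel hv hvA, FlatSpray.hor]
  ext
  · simp only [Prod.smul_fst, Prod.fst_add]
    module
  · simp only [Prod.smul_snd, Prod.snd_add]
    module

lemma dT_vproj (h : IsRegularOn F A) (hv : v ∈ (chT c).source) (hvA : v ∈ A)
    (ξ : TangentSpace 𝓘(ℝ, E).tangent v) :
    dT c v (vproj F v ξ) = dT c v ξ - FlatSpray.hor Sp[F, c] (chT c v) (dT c v ξ).1 := by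
  rw [vproj, map_smul, map_sub, h.dT_barthel hv hvA, FlatSpray.hor]
  ext
  · simp
  · simp only [Prod.smul_snd, Prod.snd_sub]
    module

lemma dT_beta (h : IsRegularOn F A) (hv : v ∈ (chT c).source) (hvA : v ∈ A)
    (w : TangentSpace 𝓘(ℝ, E) v.proj) :
    dT c v (beta F v w) = FlatSpray.hor Sp[F, c] (chT c v) (dB c v w) := by
  rw [beta, h.dT_hproj hv hvA, dT_lift_fst hv]

lemma hproj_gam (h : IsRegularOn F A) (hvA : v ∈ A) (w : TangentSpace 𝓘(ℝ, E) v.proj) :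
    hproj F v (gam v w) = 0 := by
  have hv : v ∈ (chT v).source := mem_extChartAt_source v
  have e : ((0 : E), (0 : E)) = 0 := rfl
  apply dT_injective hv
  rw [h.dT_hproj hv hvA, dT_gam hv, map_zero]
  simp [FlatSpray.hor, e]

lemma vproj_gam (h : IsRegularOn F A) (hvA : v ∈ A) (w : TangentSpace 𝓘(ℝ, E) v.proj) :
    vproj F v (gam v w) = gam v w := by
  have hv : v ∈ (chT v).source := mem_extChartAt_source v
  have e : ((0 : E), (0 : E)) = 0 := rfl
  apply dT_injective hv
  rw [h.dT_vproj hv hvA, dT_gam hv]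
  simp [FlatSpray.hor, e]

lemma hproj_beta (h : IsRegularOn F A) (hvA : v ∈ A) (w : TangentSpace 𝓘(ℝ, E) v.proj) :
    hproj F v (beta F v w) = beta F v w := by
  have hv : v ∈ (chT v).source := mem_extChartAt_source v
  apply dT_injective hv
  rw [h.dT_hproj hv hvA, h.dT_beta hv hvA]
  rfl

lemma vproj_beta (h : IsRegularOn F A) (hvA : v ∈ A) (w : TangentSpace 𝓘(ℝ, E) v.proj) :
    vproj F v (beta F v w) = 0 := by
  have hv : v ∈ (chT v).source := mem_extChartAt_source v
  apply dT_injective hv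
  rw [h.dT_vproj hv hvA, h.dT_beta hv hvA, map_zero]
  exact sub_self _

lemma repV_betaF (h : IsRegularOn F A) {q : E × E} (hq : q ∈ repSet c A) (Z : PiField E M) :
    repV c (betaF F Z) q = FlatSpray.hor Sp[F, c] q (repP c Z q) := by
  have h1 := h.dT_beta ((chT c).map_target hq.1) hq.2 (Z ((chT c).symm q))
  rw [(chT c).right_inv hq.1] at h1
  exact h1

lemma contDiffAt_hor (h : IsRegularOn F A) (hv : v ∈ (chT c).source) (hvA : v ∈ A)
    {w : E × E → E} (hw : ContDiffAt ℝ ∞ w (chT c v)) :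
    ContDiffAt ℝ ∞ (fun q => FlatSpray.hor Sp[F, c] q (w q)) (chT c v) := by
  have hS := (h.contDiffAt_spray hv hvA).fderiv_right (m := ∞) (by simp)
  exact hw.prodMk (contDiffAt_const.smul (hS.clm_apply (contDiffAt_const.prodMk hw)).snd)

lemma contDiffAt_repV_betaF (h : IsRegularOn F A) (hv : v ∈ (chT c).source) (hvA : v ∈ A)
    {Z : PiField E M} (hZ : ContDiffAt ℝ ∞ (repP c Z) (chT c v)) :
    ContDiffAt ℝ ∞ (repV c (betaF F Z)) (chT c v) := by
  refine (h.contDiffAt_hor hv hvA hZ).congr_of_eventuallyEq ?_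
  filter_upwards [eventually_repSet h.isOpen hv hvA] with q hq using h.repV_betaF hq Z

omit [CompleteSpace E] [FiniteDimensional ℝ E] in
lemma bracket_congr {X X' Y : VField E M} (hX : X =ᶠ[𝓝 v] X') :
    bracket X Y v = bracket X' Y v :=
  hX.mlieBracket_vectorField_eq Filter.EventuallyEq.rfl

omit [CompleteSpace E] [FiniteDimensional ℝ E] in
lemma bracket_zero_left (Y : VField E M) :
    bracket (0 : VField E M) Y v = 0 := by
  rw [bracket, mlieBracket_zero_left]
  rfl

lemma vproj_zero (h : IsRegularOn F A) (hvA : v ∈ A) : vproj F v 0 = 0 := by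
  have := h.vproj_gam hvA 0
  rwa [map_zero] at this

omit [CompleteSpace E] [FiniteDimensional ℝ E] in
lemma gamInv_zero : gamInv v (0 : TangentSpace 𝓘(ℝ, E).tangent v) = 0 := by
  have hv : v ∈ (chT v).source := mem_extChartAt_source v
  apply dB_injective hv
  rw [dB_gamInv (b := 0) hv (by rw [map_zero]; rfl), map_zero]

/-- Only first components matter under ρ: that of γW is identically zero, and that of βZ is Z
whatever the connection. Hence no trace of F on the right. -/
lemma dB_rhoBracket_gamF (h : IsRegularOn F A) (hv : v ∈ (chT c).source) (hvA : v ∈ A)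
    {W Z : PiField E M} (hW : ContDiffAt ℝ ∞ (repP c W) (chT c v))
    (hZ : ContDiffAt ℝ ∞ (repP c Z) (chT c v)) :
    dB c v (rho v (bracket (gamF W) (betaF F Z) v))
      = fderiv ℝ (repP c Z) (chT c v) (0, repP c W (chT c v)) := by
  have hZ1 := hZ.differentiableAt (by simp)
  have hWg := contDiffAt_repV_gamF hv hW
  have hZb := h.contDiffAt_repV_betaF hv hvA hZ
  rw [← dT_fst hv, dT_bracket hv hWg hZb, Prod.fst_sub]
  have e1 : (fun q => (repV c (gamF W) q).1) =ᶠ[𝓝 (chT c v)] fun _ => 0 := by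
    filter_upwards [eventually_target hv] with q hq
    rw [repV_gamF hq]
  have e2 : (fun q => (repV c (betaF F Z) q).1) =ᶠ[𝓝 (chT c v)] repP c Z := by
    filter_upwards [eventually_repSet h.isOpen hv hvA] with q hq
    rw [h.repV_betaF hq]
    rfl
  have f1 := e1.fderiv_eq (𝕜 := ℝ)
  have f2 := e2.fderiv_eq (𝕜 := ℝ)
  rw [fderiv.fst (hWg.differentiableAt (by simp))] at f1
  rw [fderiv.fst (hZb.differentiableAt (by simp))] at f2
  have g1 := DFunLike.congr_fun f1 (repV c (betaF F Z) (chT c v))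
  have g2 := DFunLike.congr_fun f2 (repV c (gamF W) (chT c v))
  simp only [ContinuousLinearMap.comp_apply, ContinuousLinearMap.coe_fst'] at g1 g2
  rw [g1, g2, repV_gamF ((chT c).map_source hv)]
  simp

lemma dB_berwald_gamF (h : IsRegularOn F A) (hv : v ∈ (chT c).source) (hvA : v ∈ A)
    {W Z : PiField E M} (hW : ContDiffAt ℝ ∞ (repP c W) (chT c v))
    (hZ : ContDiffAt ℝ ∞ (repP c Z) (chT c v)) :
    dB c v (berwald F (gamF W) Z v) = fderiv ℝ (repP c Z) (chT c v) (0, repP c W (chT c v)) := by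
  have e1 : (fun u => vproj F u (gamF W u)) =ᶠ[𝓝 v] gamF W := by
    filter_upwards [h.isOpen.mem_nhds hvA] with u hu using h.vproj_gam hu _
  have e2 : (fun u => hproj F u (gamF W u)) =ᶠ[𝓝 v] (0 : VField E M) := by
    filter_upwards [h.isOpen.mem_nhds hvA] with u hu using h.hproj_gam hu _
  rw [berwald, bracket_congr e1, bracket_congr e2, bracket_zero_left, h.vproj_zero hvA,
    gamInv_zero, add_zero, h.dB_rhoBracket_gamF hv hvA hW hZ]

lemma dB_berwald_betaF (h : IsRegularOn F A) (hv : v ∈ (chT c).source) (hvA : v ∈ A)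
    {W Z : PiField E M} (hW : ContDiffAt ℝ ∞ (repP c W) (chT c v))
    (hZ : ContDiffAt ℝ ∞ (repP c Z) (chT c v)) :
    dB c v (berwald F (betaF F W) Z v)
      = flatBerwald Sp[F, c] (repP c W) (repP c Z) (chT c v) := by
  have hq := chT_mem_repSet hv hvA
  have hS := h.contDiffAt_spray hv hvA
  have e1 : (fun u => vproj F u (betaF F W u)) =ᶠ[𝓝 v] (0 : VField E M) := by
    filter_upwards [h.isOpen.mem_nhds hvA] with u hu using h.vproj_beta hu _
  have e2 : (fun u => hproj F u (betaF F W u)) =ᶠ[𝓝 v] betaF F W := by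
    filter_upwards [h.isOpen.mem_nhds hvA] with u hu using h.hproj_beta hu _
  rw [berwald, bracket_congr e1, bracket_congr e2, bracket_zero_left, map_zero, zero_add]
  have hZg := contDiffAt_repV_gamF hv hZ
  have hWb := h.contDiffAt_repV_betaF hv hvA hW
  have hb := dT_bracket hv hWb hZg
  have e3 : repV c (gamF Z) =ᶠ[𝓝 (chT c v)] fun q => ((0 : E), repP c Z q) := by
    filter_upwards [eventually_target hv] with q hq using repV_gamF hq Z
  have e4 : repV c (betaF F W) =ᶠ[𝓝 (chT c v)]
      fun q => FlatSpray.hor Sp[F, c] q (repP c W q) := by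
    filter_upwards [eventually_repSet h.isOpen hv hvA] with q hq using h.repV_betaF hq W
  have hZ1 := (hZ.differentiableAt (by simp)).hasFDerivAt
  have hW1 := (hW.differentiableAt (by simp)).hasFDerivAt
  have hS2 : HasFDerivAt (fderiv ℝ Sp[F, c]) (fderiv ℝ (fderiv ℝ Sp[F, c]) (chT c v)) (chT c v) :=
    ((hS.fderiv_right (m := ∞) (by simp)).differentiableAt (by simp)).hasFDerivAt
  have d3 := ((hasFDerivAt_const (0 : E) (chT c v)).prodMk hZ1).congr_of_eventuallyEq e3
  have d4 := (hW1.prodMk ((hS2.clm_apply ((hasFDerivAt_const (0 : E) (chT c v)).prodMk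
    hW1)).snd.const_smul (1 / 2 : ℝ))).congr_of_eventuallyEq e4
  rw [d3.fderiv, d4.fderiv, e3.eq_of_nhds, e4.eq_of_nhds] at hb
  -- The bracket has first component -dW(0, Z); the vertical projector subtracts its horizontal
  -- lift, which removes every derivative of W.
  refine dB_gamInv hv ?_
  rw [h.dT_vproj hv hvA, hb]
  ext
  · simp [FlatSpray.hor]
  · simp only [flatBerwald, FlatSpray.hor]
    simp
    have e5 : ∀ x : E, ((0 : E), -x) = -(0, x) := fun x => by simp
    rw [e5, map_neg]
    simp
    abel

end IsRegularOn

end Connection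

/-! ### Solvability for the metric tensor, and independence of the energy off the domain. -/

section FlatComplements

variable {E : Type*} [NormedAddCommGroup E] [NormedSpace ℝ E]

/-- Solve for the form `flatForm` with right-hand side ℓ ∘ fst. This vanishes on vertical vectors,
which puts (0, ξ₁) in the kernel; so ξ is vertical and its second component is V. -/
lemma FlatRegular.exists_sharp [FiniteDimensional ℝ E] {Ω : Set (E × E)} {L : E × E → ℝ}
    (h : FlatRegular Ω L) {q : E × E} (hq : q ∈ Ω) (ℓ : E →L[ℝ] ℝ) :
    ∃ V, ∀ z, flatMetric L q V z = ℓ z := by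
  have e : ((0 : E), (0 : E)) = 0 := rfl
  obtain ⟨ξ, hξ⟩ := (h.flatFormL_isInvertible hq).surjective
    (ℓ.comp (ContinuousLinearMap.fst ℝ E E))
  have h1 : ∀ ζ, flatForm L q ξ ζ = ℓ ζ.1 := fun ζ => by
    rw [← h.flatFormL_apply hq, hξ]
    rfl
  have h2 : ((0 : E), ξ.1) = 0 := h.nondegenerate q hq _ fun ζ => by
    have h3 := h1 (0, ζ.1)
    rw [flatForm, e, map_zero, map_zero, zero_sub, neg_eq_zero] at h3
    rw [flatForm_vertical, h.symm hq, h3]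
  have h4 : ξ.1 = 0 := congrArg Prod.snd h2
  refine ⟨ξ.2, fun z => ?_⟩
  have h5 := h1 (z, 0)
  rw [flatForm, h4, e, map_zero, sub_zero] at h5
  have h6 : ((0 : E), ξ.2) = ξ := by rw [← h4]
  rw [flatMetric, h6]
  exact h5

/-- Needed because the expression of the changed metric agrees with `FlatConcurrent.hat` only on the
chart image of the slit bundle. -/
lemma FlatSpray.congr {Ω : Set (E × E)} {L L' : E × E → ℝ} {S : E × E → E × E}
    (h : FlatSpray Ω L S) (hL : EqOn L' L Ω) : FlatSpray Ω L' S := by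
  have e : ∀ q ∈ Ω, L' =ᶠ[𝓝 q] L := fun q hq =>
    hL.eventuallyEq_of_mem (h.isOpen.mem_nhds hq)
  have e1 : ∀ q ∈ Ω, fderiv ℝ L' q = fderiv ℝ L q := fun q hq => (e q hq).fderiv_eq
  have e2 : ∀ q ∈ Ω, ∀ ξ ζ, flatForm L' q ξ ζ = flatForm L q ξ ζ := fun q hq ξ ζ => by
    rw [flatForm, flatForm, (e q hq).fderiv.fderiv_eq]
  refine ⟨⟨h.isOpen, h.smooth.congr hL, h.scaling, fun q hq t ht => ?_, fun q hq ξ hξ => ?_⟩,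
    fun q hq ζ => ?_⟩
  · rw [hL (h.scaling q hq t ht), hL hq, h.homogeneous q hq t ht]
  · exact h.nondegenerate q hq ξ fun ζ => by rw [← e2 q hq, hξ]
  · rw [e2 q hq, e1 q hq, h.spray q hq]

end FlatComplements

/-! ### From a concurrent field on the manifold to its coordinate conditions. -/

section Concurrent

variable {E : Type*} [NormedAddCommGroup E] [NormedSpace ℝ E]
  {M : Type*} [TopologicalSpace M] [ChartedSpace E M] [IsManifold 𝓘(ℝ, E) ∞ M]
  {c v : TM E M} {F : TM E M → ℝ} {A : Set (TM E M)}

variable [CompleteSpace E] [FiniteDimensional ℝ E]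

omit [FiniteDimensional ℝ E] in
lemma IsRegularOn.metric_apply (h : IsRegularOn F A) (hv : v ∈ (chT c).source) (hvA : v ∈ A)
    (w z : TangentSpace 𝓘(ℝ, E) v.proj) :
    metric F v w z = flatMetric (flatEnergy (repF c F)) (chT c v) (dB c v w) (dB c v z) :=
  Finsler.metric_apply hv (h.contDiffAt_energy (chT_mem_repSet hv hvA)) w z

omit [FiniteDimensional ℝ E] in
lemma IsRegularOn.repF_metricF (h : IsRegularOn F A) {q : E × E} (hq : q ∈ repSet c A)
    (Y Z : PiField E M) : repF c (metricF F Y Z) q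
      = flatMetric (flatEnergy (repF c F)) q (repP c Y q) (repP c Z q) := by
  have h1 := h.metric_apply ((chT c).map_target hq.1) hq.2 (Y ((chT c).symm q))
    (Z ((chT c).symm q))
  rw [(chT c).right_inv hq.1] at h1
  exact h1

/-- Both φ and the test field are constant along the fibres, so the two bracket terms of the Cartan
formula vanish and only the derivative of g(φ, Z) survives. -/
lemma IsRegularOn.cartanV_apply (h : IsRegularOn F A) (hv : v ∈ (chT c).source) (hvA : v ∈ A)
    {W φ : PiField E M} (hW : ContDiffAt ℝ ∞ (repP c W) (chT c v))
    (hφ : ContDiffAt ℝ ∞ (repP c φ) (chT c v))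
    (hφ' : ∀ w, fderiv ℝ (repP c φ) (chT c v) (0, w) = 0) (z : TangentSpace 𝓘(ℝ, E) v.proj) :
    flatMetric (flatEnergy (repF c F)) (chT c v) (dB c v (cartanV F W φ v)) (dB c v z)
      = (1 / 2) * fderiv ℝ
        (fun r => flatMetric (flatEnergy (repF c F)) r (repP c φ r) (dB c v z)) (chT c v)
        (0, dB c v (W v)) := by
  have hq := chT_mem_repSet hv hvA
  have hR := h.flatRegular c
  have e0 : ((0 : E), (0 : E)) = 0 := rfl
  have hL2 := hR.contDiffAt_fderiv_fderiv hq
  have hD : ContDiffAt ℝ ∞ (fun r => fderiv ℝ (fderiv ℝ (flatEnergy (repF c F))) r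
      (0, repP c φ r)) (chT c v) := hL2.clm_apply (contDiffAt_const.prodMk hφ)
  have hD1 := hD.differentiableAt (by simp)
  set T := fderiv ℝ (fun r => fderiv ℝ (fderiv ℝ (flatEnergy (repF c F))) r
      (0, repP c φ r)) (chT c v) (0, dB c v (W v)) with hT
  -- the right-hand side of the defining identity
  have key : ∀ z : TangentSpace 𝓘(ℝ, E) v.proj,
      (1 / 2) * (df (metricF F φ (extPi z)) v (gamF W v)
      + metricF F φ (rhoBracket (betaF F (extPi z)) (gamF W)) v
      + metricF F (extPi z) (rhoBracket (gamF W) (betaF F φ)) v)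
      = (1 / 2) * T (0, dB c v z) := by
    intro z
    have hZ := contDiffAt_repP_extPi hv z
    have b1 : dB c v (rhoBracket (betaF F (extPi z)) (gamF W) v) = 0 := by
      have h1 := h.dB_rhoBracket_gamF hv hvA hW hZ
      rw [fderiv_repP_extPi hv] at h1
      have h2 : bracket (betaF F (extPi z)) (gamF W) v
          = -bracket (gamF W) (betaF F (extPi z)) v := mlieBracket_swap_apply
      rw [rhoBracket, h2, map_neg, map_neg, h1, neg_zero]
    have b2 : dB c v (rhoBracket (gamF W) (betaF F φ) v) = 0 :=
      (h.dB_rhoBracket_gamF hv hvA hW hφ).trans (hφ' _)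
    have e1 : repF c (metricF F φ (extPi z)) =ᶠ[𝓝 (chT c v)]
        fun r => fderiv ℝ (fderiv ℝ (flatEnergy (repF c F))) r (0, repP c φ r)
          (0, repP c (extPi z) r) := by
      filter_upwards [eventually_repSet h.isOpen hv hvA] with r hr using h.repF_metricF hr _ _
    have hZ0 : HasFDerivAt (fun r => ((0 : E), repP c (extPi z) r))
        ((0 : E × E →L[ℝ] E).prod (fderiv ℝ (repP c (extPi z)) (chT c v))) (chT c v) :=
      (hasFDerivAt_const _ _).prodMk (hZ.differentiableAt (by simp)).hasFDerivAt
    have e2 : df (metricF F φ (extPi z)) v (gamF W v) = T (0, dB c v z) := by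
      rw [df_apply hv ((hD1.clm_apply hZ0.differentiableAt).congr_of_eventuallyEq e1),
        e1.fderiv_eq, fderiv_clm_apply_apply hD1 hZ0.differentiableAt, hZ0.fderiv, gamF,
        dT_gam hv, repP_chT hv, extPi_self, ContinuousLinearMap.prod_apply,
        fderiv_repP_extPi hv, zero_apply, e0, map_zero, add_zero]
    rw [e2, metricF, h.metric_apply hv hvA, b1, metricF, h.metric_apply hv hvA, b2, flatMetric,
      flatMetric, e0, map_zero, map_zero, add_zero, add_zero]
  -- Existence is needed to use the choice in `sharp`; by `key` the right-hand side is linear in z.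
  have ex : ∃ V, ∀ z, metric F v V z
      = (1 / 2) * (df (metricF F φ (extPi z)) v (gamF W v)
      + metricF F φ (rhoBracket (betaF F (extPi z)) (gamF W)) v
      + metricF F (extPi z) (rhoBracket (gamF W) (betaF F φ)) v) := by
    obtain ⟨V, hV⟩ := hR.exists_sharp hq
      ((1 / 2 : ℝ) • T.comp (ContinuousLinearMap.inr ℝ E E))
    obtain ⟨V, rfl⟩ := (isInvertible_dB hv).surjective V
    refine ⟨V, fun z => ?_⟩
    rw [key, h.metric_apply hv hvA, hV]
    rfl
  have h1 := Classical.epsilon_spec ex z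
  rw [key, h.metric_apply hv hvA] at h1
  have h2 := fderiv_apply_const hD1 ((0 : E), dB c v z) (0, dB c v (W v))
  exact h1.trans (congrArg (fun x => (1 / 2) * x) h2.symm)

omit [CompleteSpace E] [FiniteDimensional ℝ E] in
lemma mem_slit_symm_iff {q : E × E} (hq : q ∈ (chT c).target) :
    (chT c).symm q ∈ slit E M ↔ q.2 ≠ 0 := by
  rw [mem_slit_iff ((chT c).map_target hq), (chT c).right_inv hq]

/-- A concurrent field in coordinates. -/
lemma IsConcurrent.flatConcurrent {φ : PiField E M} (hφ : IsConcurrent F φ) (hF : IsFinsler F)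
    (c : TM E M) :
    FlatConcurrent (repSet c (slit E M)) (repF c F) (repV c (geodesicSpray F)) (repP c φ) := by
  have h := hF.isRegularOn
  have hsm : ∀ q ∈ repSet c (slit E M), ContDiffAt ℝ ∞ (repP c φ) q := fun q hq =>
    contDiffAt_repP hq.1 isOpen_slit hφ.smooth hq.2
  -- test fields with a prescribed value
  have test : ∀ q ∈ repSet c (slit E M), ∀ w : E, ∃ v ∈ (chT c).source, v ∈ slit E M ∧
      chT c v = q ∧ ∃ (W : PiField E M) (U : Set (TM E M)), IsOpen U ∧ U ⊆ slit E M ∧ v ∈ U ∧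
        SmoothPi W U ∧ ContDiffAt ℝ ∞ (repP c W) (chT c v) ∧ repP c W (chT c v) = w ∧
        dB c v (W v) = w := by
    intro q hq w
    have hs := (chT c).map_target hq.1
    obtain ⟨z, hz⟩ := (isInvertible_dB hs).surjective w
    obtain ⟨U, hU, hvU, hzU⟩ := exists_smoothPi_extPi z
    have hz' : dB c ((chT c).symm q) (extPi z ((chT c).symm q)) = w := by rw [extPi_self, hz]
    exact ⟨_, hs, hq.2, (chT c).right_inv hq.1, extPi z, U ∩ slit E M, hU.inter isOpen_slit,
      inter_subset_right, ⟨hvU, hq.2⟩, hzU.mono inter_subset_left, contDiffAt_repP_extPi hs z,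
      by rw [repP_chT hs, hz'], hz'⟩
  have vert : ∀ q ∈ repSet c (slit E M), ∀ w, fderiv ℝ (repP c φ) q (0, w) = 0 := by
    intro q hq w
    obtain ⟨v, hv, hvA, rfl, W, U, hU, hUs, hvU, hWU, hW, hWw, -⟩ := test q hq w
    have h1 := h.dB_berwald_gamF hv hvA hW (hsm _ hq)
    rw [hφ.berwald_gamma U hU hUs W hWU v hvU, map_zero, hWw] at h1
    exact h1.symm
  refine ⟨fun q hq => (h.contDiffAt_repF hq).contDiffWithinAt, h.flatSpray c,
    fun q hq => (mem_slit_symm_iff hq.1).1 hq.2, fun q hq => (hsm q hq).contDiffWithinAt, vert,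
    fun q hq w z => ?_, fun q hq w => ?_⟩
  · obtain ⟨v, hv, hvA, rfl, W, U, hU, hUs, hvU, hWU, hW, -, hWw⟩ := test q hq w
    obtain ⟨z, rfl⟩ := (isInvertible_dB hv).surjective z
    have h1 := h.cartanV_apply hv hvA hW (hsm _ hq) (vert _ hq) z
    have e0 : ((0 : E), (0 : E)) = 0 := rfl
    rw [hφ.cartan_gamma U hU hUs W hWU v hvU, map_zero, hWw, flatMetric, e0, map_zero,
      zero_apply] at h1
    linarith
  · obtain ⟨v, hv, hvA, rfl, W, U, hU, hUs, hvU, hWU, hW, hWw', hWw⟩ := test q hq w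
    have h1 := h.dB_berwald_betaF hv hvA hW (hsm _ hq)
    rw [hφ.berwald_beta U hU hUs W hWU v hvU, map_neg, hWw, flatBerwald, hWw'] at h1
    exact h1.symm

end Concurrent

/-! ### The functions Φ, p², f₁, f₂ and their derivatives in coordinates. -/

section Matsumoto

variable {E : Type*} [NormedAddCommGroup E] [NormedSpace ℝ E]
  {M : Type*} [TopologicalSpace M] [ChartedSpace E M] [IsManifold 𝓘(ℝ, E) ∞ M]
  {c v : TM E M} {F : TM E M → ℝ} {A : Set (TM E M)} {φ : PiField E M}
  [CompleteSpace E] [FiniteDimensional ℝ E]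

namespace IsRegularOn

omit [FiniteDimensional ℝ E] in
lemma repF_Phi (h : IsRegularOn F A) {q : E × E} (hq : q ∈ repSet c A) :
    repF c (Phi F φ) q = FlatConcurrent.phiFun (repF c F) (repP c φ) q := by
  rw [Phi, h.repF_metricF hq, repP_eta hq.1]
  rfl

omit [FiniteDimensional ℝ E] in
lemma repF_pSq (h : IsRegularOn F A) {q : E × E} (hq : q ∈ repSet c A) :
    repF c (pSq F φ) q = FlatConcurrent.sqFun (repF c F) (repP c φ) q :=
  h.repF_metricF hq φ φ

omit [FiniteDimensional ℝ E] in
lemma repF_matsumoto (h : IsRegularOn F A) {q : E × E} (hq : q ∈ repSet c A) :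
    repF c (matsumoto F φ) q = FlatConcurrent.hat (repF c F) (repP c φ) q := by
  rw [FlatConcurrent.hat, ← h.repF_Phi hq]
  rfl

omit [FiniteDimensional ℝ E] in
lemma repF_matsumotoDenom (h : IsRegularOn F A) {q : E × E} (hq : q ∈ repSet c A) :
    repF c (matsumotoDenom F φ) q = FlatConcurrent.denom (repF c F) (repP c φ) q := by
  rw [FlatConcurrent.denom, ← h.repF_Phi hq, ← h.repF_pSq hq]
  rfl

lemma repF_f₁ (h : IsRegularOn F A) {q : E × E} (hq : q ∈ repSet c A) :
    repF c (f₁ F φ) q = FlatConcurrent.coef₁ (repF c F) (repP c φ) q := by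
  rw [FlatConcurrent.coef₁, ← h.repF_Phi hq, ← h.repF_matsumotoDenom hq]
  rfl

lemma repF_f₂ (h : IsRegularOn F A) {q : E × E} (hq : q ∈ repSet c A) :
    repF c (f₂ F φ) q = FlatConcurrent.coef₂ (repF c F) (repP c φ) q := by
  rw [FlatConcurrent.coef₂, ← h.repF_matsumotoDenom hq]
  rfl

/-- J ∘ β = γ, so the result is a vertical derivative and does not depend on the connection. -/
lemma dJ_beta (h : IsRegularOn F A) (hv : v ∈ (chT c).source) (hvA : v ∈ A)
    {f : TM E M → ℝ} {g : E × E → ℝ} (hfg : repF c f =ᶠ[𝓝 (chT c v)] g)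
    (hg : ContDiffAt ℝ ∞ g (chT c v)) (w : TangentSpace 𝓘(ℝ, E) v.proj) :
    dJ f v (beta F v w) = fderiv ℝ g (chT c v) (0, dB c v w) := by
  rw [dJ_apply hv ((hg.congr_of_eventuallyEq hfg).differentiableAt (by simp)),
    h.dT_beta hv hvA, hfg.fderiv_eq]
  rfl

/-- With one vertical argument the form sees only the base component of the other, so β contributes
just w. -/
lemma ddJ_gam_beta (h : IsRegularOn F A) (hv : v ∈ (chT c).source) (hvA : v ∈ A)
    {f : TM E M → ℝ} {g : E × E → ℝ} (hfg : repF c f =ᶠ[𝓝 (chT c v)] g)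
    (hg : ContDiffAt ℝ ∞ g (chT c v)) (z w : TangentSpace 𝓘(ℝ, E) v.proj) :
    ddJ f v (gam v z) (beta F v w)
      = fderiv ℝ (fderiv ℝ g) (chT c v) (0, dB c v z) (0, dB c v w) := by
  rw [ddJ_apply hv (hg.congr_of_eventuallyEq hfg), dT_gam hv, flatForm_vertical,
    h.dT_beta hv hvA, hfg.fderiv.fderiv_eq]
  rfl

end IsRegularOn

end Matsumoto

end Finsler

end

/-! ### Assembly in the chart centred at u. -/

theorem mainTheorem8
    {E : Type*} [NormedAddCommGroup E] [NormedSpace ℝ E] [FiniteDimensional ℝ E]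
    {M : Type*} [TopologicalSpace M] [T2Space M] [ParacompactSpace M]
    [ChartedSpace E M] [IsManifold 𝓘(ℝ, E) ∞ M]
    (F : Finsler.TM E M → ℝ) (hF : Finsler.IsFinsler F)
    (φ : Finsler.PiField E M) (hφ : Finsler.IsConcurrent F φ)
    (hhat : Finsler.IsConicPseudoFinsler (Finsler.matsumotoDomain F φ) (Finsler.matsumoto F φ))
    (hden : ∀ u ∈ Finsler.matsumotoDomain F φ, Finsler.matsumotoDenom F φ u ≠ 0)
    (U : Set (Finsler.TM E M)) (hU : IsOpen U) (hUD : U ⊆ Finsler.matsumotoDomain F φ)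
    (W Z : Finsler.PiField E M) (hW : Finsler.SmoothPi W U) (hZ : Finsler.SmoothPi Z U)
    (u : Finsler.TM E M) (hu : u ∈ U) :
    Finsler.berwald (Finsler.matsumoto F φ) (Finsler.gamF W) Z u
        = Finsler.berwald F (Finsler.gamF W) Z u ∧
      Finsler.berwald (Finsler.matsumoto F φ) (Finsler.betaF (Finsler.matsumoto F φ) W) Z u
        = Finsler.berwald F (Finsler.betaF F W) Z u
          - (1 / 2 : ℝ) •
            (Finsler.f₁ F φ u • Finsler.berwald F (Finsler.gamF W) Z u
              + Finsler.dJ (Finsler.f₁ F φ) u (Finsler.beta F u (W u)) •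
                  Finsler.berwald F (Finsler.gamF Finsler.eta) Z u
              - Finsler.dJ (Finsler.f₁ F φ) u (Finsler.beta F u (W u)) • Z u
              - Finsler.dJ (Finsler.f₁ F φ) u (Finsler.beta F u (Z u)) • W u
              - Finsler.dJ (Finsler.f₂ F φ) u (Finsler.beta F u (W u)) •
                  Finsler.berwald F (Finsler.gamF φ) Z u)
          + (1 / 2 : ℝ) •
            (Finsler.ddJ (Finsler.f₁ F φ) u
                  (Finsler.gam u (Z u)) (Finsler.beta F u (W u)) • Finsler.eta u
              - Finsler.ddJ (Finsler.f₂ F φ) u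
                  (Finsler.gam u (Z u)) (Finsler.beta F u (W u)) • φ u) := by
  open Finsler in
  have : CompleteSpace E := FiniteDimensional.complete ℝ E
  have hR := hF.isRegularOn
  have hR' := hhat.isRegularOn
  have hv : u ∈ (chT u).source := mem_extChartAt_source u
  have huD := hUD hu
  have hus : u ∈ slit E M := huD.1
  have hq := (chT u).map_source hv
  have hqs := chT_mem_repSet hv hus
  have hqD := chT_mem_repSet hv huD
  have hsub : repSet u (matsumotoDomain F φ) ⊆ repSet u (slit E M) := fun q h => ⟨h.1, h.2.1⟩
  have hC := hφ.flatConcurrent hF u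
  have hS' : FlatSpray (repSet u (matsumotoDomain F φ))
      (flatEnergy (FlatConcurrent.hat (repF u F) (repP u φ)))
      (repV u (geodesicSpray (matsumoto F φ))) :=
    (hR'.flatSpray u).congr fun q hq => by
      simp only [flatEnergy]
      rw [hR.repF_matsumoto (hsub hq)]
  have hD : ∀ q ∈ repSet u (matsumotoDomain F φ),
      repF u F q - FlatConcurrent.phiFun (repF u F) (repP u φ) q ≠ 0 := fun q hq => by
    rw [← hR.repF_Phi (hsub hq)]
    exact (sub_pos.2 hq.2.2).ne'
  have hd : ∀ q ∈ repSet u (matsumotoDomain F φ),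
      FlatConcurrent.denom (repF u F) (repP u φ) q ≠ 0 := fun q hq => by
    rw [← hR.repF_matsumotoDenom (hsub hq)]
    exact hden _ hq.2
  have hquU : (chT u).symm (chT u u) ∈ U := by rwa [(chT u).left_inv hv]
  have hWs := contDiffAt_repP hq hU hW hquU
  have hZs := contDiffAt_repP hq hU hZ hquU
  have hes : ContDiffAt ℝ ∞ (repP u eta) (chT u u) := by
    refine contDiffAt_snd.congr_of_eventuallyEq ?_
    filter_upwards [eventually_target hv] with r hr using repP_eta hr
  have hφs := hC.contDiffAt_field hqs
  have e1 : repF u (f₁ F φ) =ᶠ[𝓝 (chT u u)] FlatConcurrent.coef₁ (repF u F) (repP u φ) := by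
    filter_upwards [eventually_repSet isOpen_slit hv hus] with r hr using hR.repF_f₁ hr
  have e2 : repF u (f₂ F φ) =ᶠ[𝓝 (chT u u)] FlatConcurrent.coef₂ (repF u F) (repP u φ) := by
    filter_upwards [eventually_repSet isOpen_slit hv hus] with r hr using hR.repF_f₂ hr
  have c1 := hC.contDiffAt_coef₁ hqs (hd _ hqD)
  have c2 := hC.contDiffAt_coef₂ hqs (hd _ hqD)
  have hf1 : f₁ F φ u = FlatConcurrent.coef₁ (repF u F) (repP u φ) (chT u u) := by
    rw [← repF_chT hv (f₁ F φ), e1.eq_of_nhds]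
  have key := hC.flatBerwald_hat hS' hsub hD hd hqD (repP u W) (repP u Z)
  -- The derivative of the base chart is injective, so both identities may be compared in
  -- coordinates: in the first the two sides have the same expression, the second is `key`.
  refine ⟨dB_injective hv ?_, dB_injective hv ?_⟩
  · rw [hR'.dB_berwald_gamF hv huD hWs hZs, hR.dB_berwald_gamF hv hus hWs hZs]
  · simp only [map_sub, map_add, map_smul]
    rw [hR'.dB_berwald_betaF hv huD hWs hZs, key, hR.dB_berwald_betaF hv hus hWs hZs,
      hR.dB_berwald_gamF hv hus hWs hZs, hR.dB_berwald_gamF hv hus hes hZs,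
      hR.dB_berwald_gamF hv hus hφs hZs, hf1, hR.dJ_beta hv hus e1 c1, hR.dJ_beta hv hus e1 c1,
      hR.dJ_beta hv hus e2 c2, hR.ddJ_gam_beta hv hus e1 c1, hR.ddJ_gam_beta hv hus e2 c2,
      repP_eta hq, repP_chT hv, repP_chT hv, repP_chT hv, ← repP_chT hv eta, repP_eta hq]
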